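/- Let $d\ge 1$ be an integer and let $\mathbb L=\mathbb C(u,v,z)$ be the field of rational functions in three indeterminates. For $n\ge 1$ let $Y_n=Y^{B}_{d,n}$ be the unital associative $\mathbb L$-algebra generated by $b_1$, $g_1,\dots,g_{n-1}$, $t_1,\dots,t_n$ subject to $$g_ig_j=g_jg_i\ (|i-j|>1),\qquad g_ig_jg_i=g_jg_ig_j\ (|i-j|=1),\qquad b_1g_i=g_ib_1\ (i\ne1),\qquad b_1g_1b_1g_1=g_1b_1g_1b_1,$$ $$t_it_j=t_jt_i,\qquad t_jg_i=g_it_{s_i(j)},\qquad t_ib_1=b_1t_i,\qquad t_i^d=1,$$ $$g_i^2=1+(u-u^{-1})e_ig_i,\qquad b_1^2=1+(v-v^{-1})f_1b_1,$$ where $s_i$ is the transposition $(i,\,i+1)$, $e_i=\frac1d\sum_{m=0}^{d-1}t_i^mt_{i+1}^{d-m}$ and $f_1=\frac1d\sum_{m=0}^{d-1}t_1^m$. Put $Y_0=\mathbb L$. Elements of $Y_n$ are regarded as elements of $Y_{n+1}$ via the natural algebra homomorphism $Y_n\to Y_{n+1}$ sending each generator to the generator of the same name. The $g_i$ are invertible;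 put $b_k=g_{k-1}\cdots g_1b_1g_1^{-1}\cdots g_{k-1}^{-1}$, and for $1\le j\le k$, $0\le a\le d-1$, $$\mathfrak m^+_{k,j,a}=g_{k-1}\cdots g_jt_j^a,\qquad \mathfrak m^-_{k,j,a}=g_{k-1}\cdots g_jb_jt_j^a$$ (so $\mathfrak m^+_{k,k,a}=t_k^a$ and $\mathfrak m^-_{k,k,a}=b_kt_k^a$). Let $M_k$ be the set of all $\mathfrak m^{\pm}_{k,j,a}$ and let $C_n\subseteq Y_n$ be the set of all products $\mathfrak m_1\mathfrak m_2\cdots\mathfrak m_n$ with $\mathfrak m_k\in M_k$ (so $C_0=\{1\}$). Let $x_0=1$ and let $x_1,\dots,x_{d-1},y_0,\dots,y_{d-1}\in\mathbb L$ be arbitrary. Then: 1. For every $n\ge0$, $C_n$ is an $\mathbb L$-basis of $Y_n$. 2. There is a unique family of $\mathbb L$-linear maps $\mathrm{tr}_n:Y_n\to Y_{n-1}$ $(n\ge1)$ such that for all $w\in C_{n-1}$ and $0\le a\le d-1$, $$\mathrm{tr}_n(wt_n^a)=x_aw,\qquad \mathrm{tr}_n(wb_nt_n^a)=y_aw,\qquad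 \mathrm{tr}_n(w\,\mathfrak m^{\pm}_{n,k,a})=z\,w\,\mathfrak m^{\pm}_{n-1,k,a}\quad(1\le k\le n-1).$$ 3. The linear maps $\mathrm{Tr}_n=\mathrm{tr}_1\circ\cdots\circ\mathrm{tr}_n:Y_n\to\mathbb L$ satisfy, for all $n\ge1$, $X,X'\in Y_n$ and $0\le m\le d-1$: (i) $\mathrm{Tr}_n(1)=1$; (ii) $\mathrm{Tr}_{n+1}(Xg_n)=z\,\mathrm{Tr}_n(X)$; (iii) $\mathrm{Tr}_{n+1}(Xb_{n+1}t_{n+1}^m)=y_m\,\mathrm{Tr}_n(X)$; (iv) $\mathrm{Tr}_{n+1}(Xt_{n+1}^m)=x_m\,\mathrm{Tr}_n(X)$; (v) $\mathrm{Tr}_n(XX')=\mathrm{Tr}_n(X'X)$. That is, $(\mathrm{Tr}_n)_{n\ge1}$ is a Markov trace on the tower of algebras $(Y_n)_{n\ge 1}$. 4. $(\mathrm{Tr}_n)_{n\ge1}$ is the only family of $\mathbb L$-linear maps $Y_n\to\mathbb L$ satisfying (i)–(v) for all $n\ge1$. -/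

import Mathlib

noncomputable section

namespace FramedB

/-- The field `ℂ(u, v, z)` of rational functions in three indeterminates. -/
abbrev 𝕃 : Type := FractionRing (MvPolynomial (Fin 3) ℂ)

/-- The indeterminate `u`. -/
def pu : 𝕃 := algebraMap (MvPolynomial (Fin 3) ℂ) 𝕃 (MvPolynomial.X 0)

/-- The indeterminate `v`. -/
def pv : 𝕃 := algebraMap (MvPolynomial (Fin 3) ℂ) 𝕃 (MvPolynomial.X 1)

/-- The indeterminate `z`. -/
def pz : 𝕃 := algebraMap (MvPolynomial (Fin 3) ℂ) 𝕃 (MvPolynomial.X 2)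

/-- The generators `b₁` (present when `1 ≤ n`), `g₁, …, gₙ₋₁` and `t₁, …, tₙ`. -/
inductive Gen (n : ℕ) : Type
  | b (h : 1 ≤ n) : Gen n
  | g (i : ℕ) (h : 1 ≤ i ∧ i + 1 ≤ n) : Gen n
  | t (j : ℕ) (h : 1 ≤ j ∧ j ≤ n) : Gen n

/-- Free algebra on the generators. -/
abbrev Free (n : ℕ) : Type := FreeAlgebra 𝕃 (Gen n)

/-- `b₁` in the free algebra; an index out of range is never used and gives the value `1`. -/
def fb (n : ℕ) : Free n := if h : 1 ≤ n then FreeAlgebra.ι 𝕃 (Gen.b h) else 1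

/-- `gᵢ` in the free algebra, for `1 ≤ i ≤ n - 1`. -/
def fg (n i : ℕ) : Free n :=
  if h : 1 ≤ i ∧ i + 1 ≤ n then FreeAlgebra.ι 𝕃 (Gen.g i h) else 1

/-- `tⱼ` in the free algebra, for `1 ≤ j ≤ n`. -/
def ft (n j : ℕ) : Free n :=
  if h : 1 ≤ j ∧ j ≤ n then FreeAlgebra.ι 𝕃 (Gen.t j h) else 1

/-- `eᵢ = (1/d) ∑ₘ tᵢ^m tᵢ₊₁^(d-m)` in the free algebra. -/
def fe (d n i : ℕ) : Free n :=
  (d : 𝕃)⁻¹ • ∑ m ∈ Finset.range d, ft n i ^ m * ft n (i + 1) ^ (d - m)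

/-- `f₁ = (1/d) ∑ₘ t₁^m` in the free algebra. -/
def ff (d n : ℕ) : Free n := (d : 𝕃)⁻¹ • ∑ m ∈ Finset.range d, ft n 1 ^ m

/-- The defining relations of `Y_{d,n}^B`. The index range of each relation is made explicit, so
that only genuine generators occur. -/
inductive Rel (d n : ℕ) : Free n → Free n → Prop
  | g_comm (i j : ℕ) (hi : 1 ≤ i ∧ i + 1 ≤ n) (hj : 1 ≤ j ∧ j + 1 ≤ n)
      (hij : i + 1 < j ∨ j + 1 < i) : Rel d n (fg n i * fg n j) (fg n j * fg n i)
  | g_braid (i j : ℕ) (hi : 1 ≤ i ∧ i + 1 ≤ n) (hj : 1 ≤ j ∧ j + 1 ≤ n)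
      (hij : i + 1 = j ∨ j + 1 = i) :
      Rel d n (fg n i * fg n j * fg n i) (fg n j * fg n i * fg n j)
  | b_g_comm (i : ℕ) (hi : 1 ≤ i ∧ i + 1 ≤ n) (hi1 : i ≠ 1) :
      Rel d n (fb n * fg n i) (fg n i * fb n)
  | b_g_braid (hn : 2 ≤ n) :
      Rel d n (fb n * fg n 1 * fb n * fg n 1) (fg n 1 * fb n * fg n 1 * fb n)
  | t_comm (i j : ℕ) (hi : 1 ≤ i ∧ i ≤ n) (hj : 1 ≤ j ∧ j ≤ n) :
      Rel d n (ft n i * ft n j) (ft n j * ft n i)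
  | t_g (i j : ℕ) (hi : 1 ≤ i ∧ i + 1 ≤ n) (hj : 1 ≤ j ∧ j ≤ n) :
      Rel d n (ft n j * fg n i) (fg n i * ft n (Equiv.swap i (i + 1) j))
  | t_b (j : ℕ) (hj : 1 ≤ j ∧ j ≤ n) : Rel d n (ft n j * fb n) (fb n * ft n j)
  | t_pow (j : ℕ) (hj : 1 ≤ j ∧ j ≤ n) : Rel d n (ft n j ^ d) 1
  | g_sq (i : ℕ) (hi : 1 ≤ i ∧ i + 1 ≤ n) :
      Rel d n (fg n i ^ 2) (1 + (pu - pu⁻¹) • (fe d n i * fg n i))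
  | b_sq (hn : 1 ≤ n) : Rel d n (fb n ^ 2) (1 + (pv - pv⁻¹) • (ff d n * fb n))

/-- The algebra `Y_{d,n}^B` over `ℂ(u, v, z)`, by generators and relations. For `n = 0` there are
no generators and this is the ground field. -/
def Y (d n : ℕ) : Type := RingQuot (Rel d n)

instance (d n : ℕ) : Ring (Y d n) := inferInstanceAs (Ring (RingQuot (Rel d n)))

instance (d n : ℕ) : Algebra 𝕃 (Y d n) := inferInstanceAs (Algebra 𝕃 (RingQuot (Rel d n)))

/-- The projection of the free algebra onto `Y_{d,n}^B`. -/
def proj (d n : ℕ) : Free n →ₐ[𝕃] Y d n := RingQuot.mkAlgHom 𝕃 (Rel d n)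

/-- `b₁` in `Y_{d,n}^B`. -/
def b (d n : ℕ) : Y d n := proj d n (fb n)

/-- `gᵢ` in `Y_{d,n}^B`. -/
def g (d n i : ℕ) : Y d n := proj d n (fg n i)

/-- `tⱼ` in `Y_{d,n}^B`. -/
def t (d n j : ℕ) : Y d n := proj d n (ft n j)

/-- `eᵢ` in `Y_{d,n}^B`. -/
def e (d n i : ℕ) : Y d n :=
  (d : 𝕃)⁻¹ • ∑ m ∈ Finset.range d, t d n i ^ m * t d n (i + 1) ^ (d - m)

/-- The inverse of `gᵢ`, that is `gᵢ - (u - u⁻¹) eᵢ`. -/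
def gInv (d n i : ℕ) : Y d n := g d n i - (pu - pu⁻¹) • e d n i

theorem proj_rel {d n : ℕ} {p q : Free n} (h : Rel d n p q) : proj d n p = proj d n q :=
  RingQuot.mkAlgHom_rel 𝕃 h

theorem proj_fe (d n i : ℕ) : proj d n (fe d n i) = e d n i := by
  simp [fe, e, t, map_sum]

theorem t_mul_g (d n i j : ℕ) (hi : 1 ≤ i ∧ i + 1 ≤ n) (hj : 1 ≤ j ∧ j ≤ n) :
    t d n j * g d n i = g d n i * t d n (Equiv.swap i (i + 1) j) := by
  simpa [t, g] using proj_rel (Rel.t_g (d := d) i j hi hj)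

theorem t_pow_d (d n j : ℕ) (hj : 1 ≤ j ∧ j ≤ n) : t d n j ^ d = 1 := by
  simpa [t] using proj_rel (Rel.t_pow (d := d) j hj)

theorem t_comm (d n i j : ℕ) (hi : 1 ≤ i ∧ i ≤ n) (hj : 1 ≤ j ∧ j ≤ n) :
    Commute (t d n i) (t d n j) := by
  simpa [t, Commute, SemiconjBy] using proj_rel (Rel.t_comm (d := d) i j hi hj)

theorem e_comm_g (d n i : ℕ) (hi : 1 ≤ i ∧ i + 1 ≤ n) : Commute (e d n i) (g d n i) := by
  have h1 : SemiconjBy (g d n i) (t d n (i + 1)) (t d n i) := by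
    have := t_mul_g d n i i hi ⟨hi.1, by omega⟩
    rw [Equiv.swap_apply_left] at this
    exact this.symm
  have h2 : SemiconjBy (g d n i) (t d n i) (t d n (i + 1)) := by
    have := t_mul_g d n i (i + 1) hi ⟨by omega, hi.2⟩
    rw [Equiv.swap_apply_right] at this
    exact this.symm
  have hc := t_comm d n i (i + 1) ⟨hi.1, by omega⟩ ⟨by omega, hi.2⟩
  have hp := t_pow_d d n i ⟨hi.1, by omega⟩
  have hq := t_pow_d d n (i + 1) ⟨by omega, hi.2⟩
  have hsum : ∑ m ∈ Finset.range d, t d n i ^ (d - m) * t d n (i + 1) ^ m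
      = ∑ m ∈ Finset.range d, t d n i ^ m * t d n (i + 1) ^ (d - m) := by
    rcases d with _ | k
    · simp
    · rw [Finset.sum_range_succ', Finset.sum_range_succ', ← Finset.sum_range_reflect]
      simp only [Nat.sub_zero, pow_zero, hp, hq]
      congr 1
      refine Finset.sum_congr rfl fun m hm => ?_
      have hm' := Finset.mem_range.mp hm
      congr 2 <;> omega
  have h3 : e d n i * g d n i = g d n i * e d n i := by
    unfold e
    rw [smul_mul_assoc, mul_smul_comm]
    congr 1
    nth_rewrite 2 [← hsum]
    rw [Finset.sum_mul, Finset.mul_sum]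
    refine Finset.sum_congr rfl fun m _ => ?_
    rw [mul_assoc, ← (h2.pow_right (d - m)).eq, ← mul_assoc, ← (h1.pow_right m).eq, mul_assoc,
      (hc.symm.pow_pow m (d - m)).eq]
  exact h3

theorem g_sq (d n i : ℕ) (hi : 1 ≤ i ∧ i + 1 ≤ n) :
    g d n i * g d n i = 1 + (pu - pu⁻¹) • (e d n i * g d n i) := by
  have := proj_rel (Rel.g_sq (d := d) i hi)
  simpa [proj_fe, pow_two, g] using this

theorem g_mul_gInv (d n i : ℕ) (hi : 1 ≤ i ∧ i + 1 ≤ n) : g d n i * gInv d n i = 1 := by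
  rw [gInv, mul_sub, g_sq d n i hi, mul_smul_comm, (e_comm_g d n i hi).eq]
  simp

theorem gInv_mul_g (d n i : ℕ) (hi : 1 ≤ i ∧ i + 1 ≤ n) : gInv d n i * g d n i = 1 := by
  rw [gInv, sub_mul, g_sq d n i hi, smul_mul_assoc]
  simp

/-- `bₖ = gₖ₋₁ ⋯ g₁ b₁ g₁⁻¹ ⋯ gₖ₋₁⁻¹` in `Y_{d,n}^B`, for `1 ≤ k ≤ n`. -/
def bAt (d n : ℕ) : ℕ → Y d n
  | 0 => 1
  | 1 => b d n
  | k + 2 => g d n (k + 1) * bAt d n (k + 1) * gInv d n (k + 1)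

/-- For `1 ≤ j ≤ k ≤ n`, the element `gₖ₋₁ ⋯ gⱼ tⱼ^a` (sign `false`, written `m⁺_{k,j,a}`) or
`gₖ₋₁ ⋯ gⱼ bⱼ tⱼ^a` (sign `true`, written `m⁻_{k,j,a}`) of `Y_{d,n}^B`. -/
def mElt (d n : ℕ) (s : Bool) (j a : ℕ) : ℕ → Y d n
  | 0 => 1
  | k + 1 =>
    if j = k + 1 then (if s then bAt d n j * t d n j ^ a else t d n j ^ a)
    else g d n k * mElt d n s j a k

/-- The set `M_{d,k}`, inside `Y_{d,n}^B`. -/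
def M (d n k : ℕ) : Set (Y d n) :=
  {p | ∃ (s : Bool) (j a : ℕ), 1 ≤ j ∧ j ≤ k ∧ a < d ∧ p = mElt d n s j a k}

/-- Lifting generators to the next algebra of the tower. -/
def genMap (d n : ℕ) : Gen n → Y d (n + 1)
  | .b _ => b d (n + 1)
  | .g i _ => g d (n + 1) i
  | .t j _ => t d (n + 1) j

theorem lift_fb (d n : ℕ) (h : 1 ≤ n) :
    FreeAlgebra.lift 𝕃 (genMap d n) (fb n) = proj d (n + 1) (fb (n + 1)) := by
  simp [fb, h, genMap, b]

theorem lift_fg (d n i : ℕ) (h : 1 ≤ i ∧ i + 1 ≤ n) :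
    FreeAlgebra.lift 𝕃 (genMap d n) (fg n i) = proj d (n + 1) (fg (n + 1) i) := by
  rw [fg, dif_pos h]; simp [genMap, g]

theorem lift_ft (d n j : ℕ) (h : 1 ≤ j ∧ j ≤ n) :
    FreeAlgebra.lift 𝕃 (genMap d n) (ft n j) = proj d (n + 1) (ft (n + 1) j) := by
  rw [ft, dif_pos h]; simp [genMap, t]

theorem swap_range {n i j : ℕ} (hi : 1 ≤ i ∧ i + 1 ≤ n) (hj : 1 ≤ j ∧ j ≤ n) :
    1 ≤ Equiv.swap i (i + 1) j ∧ Equiv.swap i (i + 1) j ≤ n := by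
  rw [Equiv.swap_apply_def]; split_ifs <;> omega

theorem lift_rel (d n : ℕ) {p q : Free n} (h : Rel d n p q) :
    FreeAlgebra.lift 𝕃 (genMap d n) p = FreeAlgebra.lift 𝕃 (genMap d n) q := by
  have up : ∀ {k : ℕ}, 1 ≤ k ∧ k ≤ n → 1 ≤ k ∧ k ≤ n + 1 := fun h => ⟨h.1, by omega⟩
  have ug : ∀ {k : ℕ}, 1 ≤ k ∧ k + 1 ≤ n → 1 ≤ k ∧ k + 1 ≤ n + 1 := fun h => ⟨h.1, by omega⟩
  induction h with
  | g_comm i j hi hj hij =>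
    have := proj_rel (Rel.g_comm (d := d) i j (ug hi) (ug hj) hij)
    simpa [lift_fg, hi, hj] using this
  | g_braid i j hi hj hij =>
    have := proj_rel (Rel.g_braid (d := d) i j (ug hi) (ug hj) hij)
    simpa [lift_fg, hi, hj] using this
  | b_g_comm i hi hi1 =>
    have := proj_rel (Rel.b_g_comm (d := d) i (ug hi) hi1)
    simpa only [map_mul, lift_fg d n i hi, lift_fb d n (by omega)] using this
  | b_g_braid hn =>
    have := proj_rel (Rel.b_g_braid (d := d) (n := n + 1) (by omega))
    simpa only [map_mul, lift_fg d n 1 ⟨le_rfl, hn⟩, lift_fb d n (by omega)] using this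
  | t_comm i j hi hj =>
    have := proj_rel (Rel.t_comm (d := d) i j (up hi) (up hj))
    simpa only [map_mul, lift_ft d n i hi, lift_ft d n j hj] using this
  | t_g i j hi hj =>
    have := proj_rel (Rel.t_g (d := d) i j (ug hi) (up hj))
    simpa only [map_mul, lift_fg d n i hi, lift_ft d n j hj,
      lift_ft d n _ (swap_range hi hj)] using this
  | t_b j hj =>
    have := proj_rel (Rel.t_b (d := d) j (up hj))
    simpa only [map_mul, lift_fb d n (by omega), lift_ft d n j hj] using this
  | t_pow j hj =>
    have := proj_rel (Rel.t_pow (d := d) j (up hj))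
    simpa only [map_pow, map_one, lift_ft d n j hj] using this
  | g_sq i hi =>
    have := proj_rel (Rel.g_sq (d := d) i (ug hi))
    simpa only [map_pow, map_mul, map_add, map_one, map_smul, fe, map_sum, lift_fg d n i hi,
      lift_ft d n i ⟨hi.1, by omega⟩, lift_ft d n (i + 1) ⟨by omega, hi.2⟩] using this
  | b_sq hn =>
    have := proj_rel (Rel.b_sq (d := d) (n := n + 1) (by omega))
    simpa only [map_pow, map_mul, map_add, map_one, map_smul, ff, map_sum, lift_fb d n hn,
      lift_ft d n 1 ⟨le_rfl, hn⟩] using this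

/-- The natural map `Y_{d,n}^B → Y_{d,n+1}^B` of the tower, sending each generator to the generator
of the same name. -/
def incl (d n : ℕ) : Y d n →ₐ[𝕃] Y d (n + 1) :=
  RingQuot.liftAlgHom 𝕃 ⟨FreeAlgebra.lift 𝕃 (genMap d n), fun _ _ h => lift_rel d n h⟩

/-- The set `C_n` of products `m₁ m₂ ⋯ mₙ` with `mₖ ∈ M_{d,k}`. -/
def C (d : ℕ) : (n : ℕ) → Set (Y d n)
  | 0 => {1}
  | n + 1 => {p | ∃ w ∈ C d n, ∃ m ∈ M d (n + 1) (n + 1), p = incl d n w * m}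

theorem lift_rel_zero (d : ℕ) {p q : Free 0} (h : Rel d 0 p q) :
    FreeAlgebra.lift 𝕃 (fun _ : Gen 0 => (0 : 𝕃)) p
      = FreeAlgebra.lift 𝕃 (fun _ : Gen 0 => (0 : 𝕃)) q := by
  induction h <;> omega

/-- The identification of `Y_{d,0}^B` with the ground field (`Gen 0` is empty). -/
def ground (d : ℕ) : Y d 0 →ₐ[𝕃] 𝕃 :=
  RingQuot.liftAlgHom 𝕃 ⟨FreeAlgebra.lift 𝕃 (fun _ : Gen 0 => (0 : 𝕃)),
    fun _ _ h => lift_rel_zero d h⟩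

theorem ground_bijective (d : ℕ) : Function.Bijective (ground d) := by
  have h : (Algebra.ofId 𝕃 (Y d 0)).comp (ground d) = AlgHom.id 𝕃 (Y d 0) := by
    apply RingQuot.ringQuot_ext'
    ext x
    rcases x with h | ⟨i, h⟩ | ⟨j, h⟩ <;> omega
  refine ⟨fun p q hpq => ?_, fun c => ⟨algebraMap 𝕃 _ c, (ground d).commutes c⟩⟩
  have hp := DFunLike.congr_fun h p
  have hq := DFunLike.congr_fun h q
  simp only [AlgHom.comp_apply, AlgHom.id_apply] at hp hq
  rw [← hp, ← hq, hpq]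

/-- `tr n : Y_{d,n+1}^B → Y_{d,n}^B` are the relative traces with parameters `z`, `x`, `y`: they
take the prescribed values on the elements `w m` of `C_{n+1}`, where `w ∈ C_n` and `m` is
`tₙ₊₁^a`, `bₙ₊₁ tₙ₊₁^a`, or `m^±_{n+1,k,a}` with `k ≤ n`. -/
def IsRelTrace (d : ℕ) (x y : Fin d → 𝕃) (tr : (n : ℕ) → Y d (n + 1) →ₗ[𝕃] Y d n) : Prop :=
  ∀ n : ℕ, ∀ w ∈ C d n, ∀ a : Fin d,
    tr n (incl d n w * t d (n + 1) (n + 1) ^ (a : ℕ)) = x a • w ∧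
    tr n (incl d n w * (bAt d (n + 1) (n + 1) * t d (n + 1) (n + 1) ^ (a : ℕ))) = y a • w ∧
    ∀ (s : Bool) (k : ℕ), 1 ≤ k → k ≤ n →
      tr n (incl d n w * mElt d (n + 1) s k a (n + 1)) = pz • (w * mElt d n s k a n)

/-- `Tr_n = tr_1 ∘ ⋯ ∘ tr_n`. -/
def bigTr (d : ℕ) (tr : (n : ℕ) → Y d (n + 1) →ₗ[𝕃] Y d n) : (n : ℕ) → Y d n →ₗ[𝕃] 𝕃
  | 0 => (ground d).toLinearMap
  | n + 1 => (bigTr d tr n).comp (tr n)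

/-- A family of linear maps `Tr_n : Y_{d,n}^B → ℂ(u, v, z)` obeys the rules of a Markov trace with
parameters `z`, `x`, `y` for all `n ≥ 1`. -/
structure IsMarkovTrace (d : ℕ) (x y : Fin d → 𝕃) (Tr : (n : ℕ) → Y d n →ₗ[𝕃] 𝕃) : Prop where
  one : ∀ n, 1 ≤ n → Tr n 1 = 1
  mul_g : ∀ n, 1 ≤ n → ∀ X : Y d n, Tr (n + 1) (incl d n X * g d (n + 1) n) = pz * Tr n X
  mul_b_t : ∀ n, 1 ≤ n → ∀ (X : Y d n) (m : Fin d),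
    Tr (n + 1) (incl d n X * bAt d (n + 1) (n + 1) * t d (n + 1) (n + 1) ^ (m : ℕ)) = y m * Tr n X
  mul_t : ∀ n, 1 ≤ n → ∀ (X : Y d n) (m : Fin d),
    Tr (n + 1) (incl d n X * t d (n + 1) (n + 1) ^ (m : ℕ)) = x m * Tr n X
  comm : ∀ n, 1 ≤ n → ∀ X X' : Y d n, Tr n (X * X') = Tr n (X' * X)

end FramedB

end

/-!
Writing `γ = gₙ`, the algebra `Yₙ₊₁` is spanned by the subspaces `Yₙ tₙ₊₁^a`, `Yₙ bₙ₊₁ tₙ₊₁^a` and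
`Yₙ γ Yₙ`, so `Cₙ` spans `Yₙ` and `dim Yₙ ≤ (2d)ⁿ n!`. The algebra `Yₙ` also acts on the functions
on coloured signed permutations, a space of exactly that dimension, and one vector generates this
module. Hence `Cₙ` is a basis and `Yₙ₊₁` is free over `Yₙ` on the products `𝔪` with index `n + 1`,
which gives the relative traces. They are bimodule maps because the commutators of `bₙ₊₁` with
elements of `Yₙ` can be written explicitly in `Yₙ γ Yₙ`.

By induction, the trace property on `Yₙ₊₂` comes down to `Tr (X γ) = Tr (γ X)` with `γ = gₙ₊₁`. For
`X = A γ C` with `A`, `C` in `Yₙ₊₁` this is the symmetry of the form `(A, C) ↦ Tr (A δ(C))`, where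
`δ(C) = tr (γ C γ) - (u - u⁻¹) z C - tr C`.
-/

noncomputable section

namespace FramedB

open Finset

variable {d n : ℕ}

local notation "ι" => incl d _
local notation "τ[" k "]" => t d k k
local notation "β[" k "]" => bAt d k k
local notation "γ[" k "]" => g d (k + 1) k
local notation "γ⁻¹[" k "]" => gInv d (k + 1) k

/-! ### Ring-theoretic generalities -/

theorem eq_of_semiconjBy {M : Type*} [Monoid M] {u x y y' : M} (hu : IsUnit u)
    (h : SemiconjBy u x y) (h' : SemiconjBy u x y') : y = y' :=
  hu.mul_left_injective (h.symm.trans h')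

theorem sum_pow_mul_pow_reflect {R : Type*} [Semiring R] {p q : R} (hp : p ^ d = 1)
    (hq : q ^ d = 1) :
    ∑ m ∈ range d, p ^ m * q ^ (d - m) = ∑ m ∈ range d, p ^ (d - m) * q ^ m := by
  rcases d with _ | k
  · simp
  · rw [sum_range_succ', sum_range_succ', ← sum_range_reflect]
    simp only [Nat.sub_zero, pow_zero, hp, hq]
    congr 1
    refine sum_congr rfl fun m hm => ?_
    have := mem_range.mp hm
    congr 2 <;> omega

/-- The elements of `A` whose right multiplication preserves the subspace `S`. -/
def rightStabilizer {R A : Type*} [CommSemiring R] [Semiring A] [Algebra R A]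
    (S : Submodule R A) : Subalgebra R A where
  carrier := {a | ∀ x ∈ S, x * a ∈ S}
  mul_mem' ha hb x hx := by rw [← mul_assoc]; exact hb _ (ha x hx)
  add_mem' ha hb x hx := by rw [mul_add]; exact S.add_mem (ha x hx) (hb x hx)
  algebraMap_mem' r x hx := by
    rw [← Algebra.commutes, ← Algebra.smul_def]; exact S.smul_mem r hx

theorem mem_rightStabilizer_span {R A : Type*} [CommSemiring R] [Semiring A] [Algebra R A]
    {s : Set A} {a : A} (h : ∀ x ∈ s, x * a ∈ Submodule.span R s) :
    a ∈ rightStabilizer (Submodule.span R s) :=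
  fun _ hx =>
    (Submodule.span_le (p := (Submodule.span R s).comap (LinearMap.mulRight R a))).mpr h hx

theorem eq_top_of_one_mem {R A : Type*} [CommSemiring R] [Semiring A] [Algebra R A]
    {S : Submodule R A} (h1 : 1 ∈ S) (h : ∀ a, a ∈ rightStabilizer S) : S = ⊤ :=
  Submodule.eq_top_iff'.mpr fun a => one_mul a ▸ h a 1 h1

/-- The elements of `A` that commute with all of `A` under the linear map `T`. -/
def traceCommutant {R A M : Type*} [CommSemiring R] [Semiring A] [Algebra R A] [AddCommMonoid M]
    [Module R M] (T : A →ₗ[R] M) : Subalgebra R A where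
  carrier := {a | ∀ x, T (x * a) = T (a * x)}
  mul_mem' {a b} ha hb x := by rw [← mul_assoc, hb, ← mul_assoc, ha, mul_assoc]
  add_mem' ha hb x := by rw [mul_add, add_mul, map_add, map_add, ha, hb]
  algebraMap_mem' r x := by rw [Algebra.commutes]

/-- Symmetry of the bilinear form `(a, b) ↦ T (a * b)`. -/
def IsTracial {R A M : Type*} [CommSemiring R] [Semiring A] [Algebra R A] [AddCommMonoid M]
    [Module R M] (T : A →ₗ[R] M) : Prop :=
  ∀ a b, T (a * b) = T (b * a)

theorem IsTracial.of_forall_mem {R A M : Type*} [CommSemiring R] [Semiring A] [Algebra R A]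
    [AddCommMonoid M] [Module R M] {T : A →ₗ[R] M} (h : ∀ a, a ∈ traceCommutant T) :
    IsTracial T :=
  fun a b => h b a

/-- The elements of `A` whose image under `f` commutes with `b` modulo the subspace `K`, which is
stable under both multiplications by the image of `f`. -/
def commutantMod {R A B : Type*} [CommRing R] [Ring A] [Algebra R A] [Ring B] [Algebra R B]
    (f : A →ₐ[R] B) (b : B) (K : Submodule R B) (hl : ∀ a, ∀ x ∈ K, f a * x ∈ K)
    (hr : ∀ a, ∀ x ∈ K, x * f a ∈ K) : Subalgebra R A where
  carrier := {a | b * f a - f a * b ∈ K}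
  mul_mem' {a a'} ha ha' := by
    have : b * f (a * a') - f (a * a') * b
        = (b * f a - f a * b) * f a' + f a * (b * f a' - f a' * b) := by
      rw [map_mul]; noncomm_ring
    change _ ∈ K
    rw [this]
    exact K.add_mem (hr _ _ ha) (hl _ _ ha')
  add_mem' {a a'} ha ha' := by
    have : b * f (a + a') - f (a + a') * b = (b * f a - f a * b) + (b * f a' - f a' * b) := by
      rw [map_add]; noncomm_ring
    change _ ∈ K
    rw [this]
    exact K.add_mem ha ha'
  algebraMap_mem' r := by
    change _ ∈ K
    rw [AlgHom.commutes, Algebra.commutes, sub_self]; exact K.zero_mem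

/-! ### Generators, relations and the tower -/

theorem g_commute_g {i j : ℕ} (hi : 1 ≤ i ∧ i + 1 ≤ n) (hj : 1 ≤ j ∧ j + 1 ≤ n)
    (hij : i + 1 < j ∨ j + 1 < i) : Commute (g d n i) (g d n j) := by
  simpa [g, Commute, SemiconjBy] using proj_rel (Rel.g_comm (d := d) i j hi hj hij)

theorem g_braid {i j : ℕ} (hi : 1 ≤ i ∧ i + 1 ≤ n) (hj : 1 ≤ j ∧ j + 1 ≤ n)
    (hij : i + 1 = j ∨ j + 1 = i) :
    g d n i * g d n j * g d n i = g d n j * g d n i * g d n j := by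
  simpa [g] using proj_rel (Rel.g_braid (d := d) i j hi hj hij)

theorem b_commute_g {i : ℕ} (hi : 1 ≤ i ∧ i + 1 ≤ n) (hi1 : i ≠ 1) :
    Commute (b d n) (g d n i) := by
  simpa [g, b, Commute, SemiconjBy] using proj_rel (Rel.b_g_comm (d := d) i hi hi1)

theorem b_braid (hn : 2 ≤ n) :
    b d n * g d n 1 * b d n * g d n 1 = g d n 1 * b d n * g d n 1 * b d n := by
  simpa [g, b] using proj_rel (Rel.b_g_braid (d := d) hn)

theorem t_commute_b {j : ℕ} (hj : 1 ≤ j ∧ j ≤ n) : Commute (t d n j) (b d n) := by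
  simpa [t, b, Commute, SemiconjBy] using proj_rel (Rel.t_b (d := d) j hj)

theorem b_mul_b (hn : 1 ≤ n) :
    b d n * b d n = 1 + (pv - pv⁻¹) • ((d : 𝕃)⁻¹ • ∑ m ∈ range d, t d n 1 ^ m) * b d n := by
  simpa [ff, b, t, pow_two, map_sum] using proj_rel (Rel.b_sq (d := d) hn)

theorem t_pow_mod {j : ℕ} (hj : 1 ≤ j ∧ j ≤ n) (a : ℕ) : t d n j ^ (a % d) = t d n j ^ a :=
  (pow_eq_pow_mod a (t_pow_d d n j hj)).symm

/-- The scalar `(u - u⁻¹) / d`. -/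
def heckeCoeff (d : ℕ) : 𝕃 := (pu - pu⁻¹) * (d : 𝕃)⁻¹

local notation "κ" => heckeCoeff d

theorem gInv_eq_sub_sum {i : ℕ} : gInv d n i
    = g d n i - heckeCoeff d • ∑ m ∈ range d, t d n i ^ m * t d n (i + 1) ^ (d - m) := by
  rw [gInv, e, heckeCoeff, mul_smul]

/-- `gᵢ` as a unit. -/
def gUnit {i : ℕ} (hi : 1 ≤ i ∧ i + 1 ≤ n) : (Y d n)ˣ :=
  ⟨g d n i, gInv d n i, g_mul_gInv d n i hi, gInv_mul_g d n i hi⟩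

theorem bAt_succ {k : ℕ} (hk : 1 ≤ k) : bAt d n (k + 1) = g d n k * bAt d n k * gInv d n k := by
  obtain ⟨k, rfl⟩ := Nat.exists_eq_add_of_le' hk
  rfl

theorem mem_of_generators {S : Subalgebra 𝕃 (Y d n)} (hb : 1 ≤ n → b d n ∈ S)
    (hg : ∀ i, 1 ≤ i ∧ i + 1 ≤ n → g d n i ∈ S) (ht : ∀ j, 1 ≤ j ∧ j ≤ n → t d n j ∈ S)
    (X : Y d n) : X ∈ S := by
  obtain ⟨f, rfl⟩ : ∃ f, proj d n f = X := RingQuot.mkAlgHom_surjective 𝕃 (Rel d n) X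
  induction f using FreeAlgebra.induction with
  | grade0 c => rw [AlgHom.commutes]; exact S.algebraMap_mem c
  | grade1 y =>
    rcases y with h | ⟨i, h⟩ | ⟨j, h⟩
    · simpa [b, fb, h] using hb h
    · simpa [g, fg, h] using hg i h
    · simpa [t, ft, h] using ht j h
  | mul x y hx hy => rw [map_mul]; exact S.mul_mem hx hy
  | add x y hx hy => rw [map_add]; exact S.add_mem hx hy

theorem gInv_mem {S : Subalgebra 𝕃 (Y d n)} {i : ℕ} (hi : 1 ≤ i ∧ i + 1 ≤ n)
    (hg : g d n i ∈ S) (ht : ∀ j, 1 ≤ j ∧ j ≤ n → t d n j ∈ S) : gInv d n i ∈ S := by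
  rw [gInv_eq_sub_sum]
  refine S.sub_mem hg (S.smul_mem (S.sum_mem fun m _ => S.mul_mem ?_ ?_) _)
  exacts [S.pow_mem (ht i ⟨hi.1, by omega⟩) m, S.pow_mem (ht (i + 1) ⟨by omega, hi.2⟩) _]

theorem mem_of_generators_last {S : Subalgebra 𝕃 (Y d n)} (hb : 1 ≤ n → bAt d n n ∈ S)
    (hg : ∀ i, 1 ≤ i ∧ i + 1 ≤ n → g d n i ∈ S) (ht : ∀ j, 1 ≤ j ∧ j ≤ n → t d n j ∈ S)
    (X : Y d n) : X ∈ S := by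
  have descend {k : ℕ} (hk : 1 ≤ k) (hkn : k ≤ n) (hbk : bAt d n k ∈ S) : b d n ∈ S := by
    induction k, hk using Nat.le_induction with
    | base => exact hbk
    | succ k hk ih =>
      have hi : 1 ≤ k ∧ k + 1 ≤ n := ⟨hk, hkn⟩
      have hconj : bAt d n k = gInv d n k * bAt d n (k + 1) * g d n k := by
        rw [bAt_succ hk]
        simp only [mul_assoc, gInv_mul_g d n k hi, mul_one]
        rw [← mul_assoc, gInv_mul_g d n k hi, one_mul]
      refine ih (by omega) (hconj ▸ S.mul_mem (S.mul_mem ?_ hbk) (hg k hi))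
      exact gInv_mem hi (hg k hi) ht
  exact mem_of_generators (fun hn => descend hn le_rfl (hb hn)) hg ht X

theorem incl_proj (f : Free n) : ι (proj d n f) = FreeAlgebra.lift 𝕃 (genMap d n) f :=
  RingQuot.liftAlgHom_mkAlgHom_apply 𝕃 (FreeAlgebra.lift 𝕃 (genMap d n))
    (fun _ _ h => lift_rel d n h) f

theorem incl_b (hn : 1 ≤ n) : ι (b d n) = b d (n + 1) := by
  rw [b, incl_proj, lift_fb d n hn]; rfl

theorem incl_g {i : ℕ} (hi : 1 ≤ i ∧ i + 1 ≤ n) : ι (g d n i) = g d (n + 1) i := by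
  rw [g, incl_proj, lift_fg d n i hi]; rfl

theorem incl_t {j : ℕ} (hj : 1 ≤ j ∧ j ≤ n) : ι (t d n j) = t d (n + 1) j := by
  rw [t, incl_proj, lift_ft d n j hj]; rfl

theorem incl_e {i : ℕ} (hi : 1 ≤ i ∧ i + 1 ≤ n) : ι (e d n i) = e d (n + 1) i := by
  have h0 : ι (t d n i) = t d (n + 1) i := incl_t ⟨hi.1, by omega⟩
  have h1 : ι (t d n (i + 1)) = t d (n + 1) (i + 1) := incl_t ⟨by omega, hi.2⟩
  simp only [e, map_smul, map_sum, map_mul, map_pow, h0, h1]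

theorem incl_gInv {i : ℕ} (hi : 1 ≤ i ∧ i + 1 ≤ n) : ι (gInv d n i) = gInv d (n + 1) i := by
  simp only [gInv, map_sub, map_smul, incl_e hi, incl_g hi]

theorem incl_bAt {k : ℕ} (hk : 1 ≤ k ∧ k ≤ n) : ι (bAt d n k) = bAt d (n + 1) k := by
  obtain ⟨h1, h2⟩ := hk
  induction k, h1 using Nat.le_induction with
  | base => exact incl_b h2
  | succ k h1 ih =>
    rw [bAt_succ h1, bAt_succ h1, map_mul, map_mul, ih (by omega), incl_g ⟨h1, h2⟩,
      incl_gInv ⟨h1, h2⟩]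

theorem mem_of_last_generators {S : Subalgebra 𝕃 (Y d (n + 2))} (hι : ∀ W : Y d (n + 1), ι W ∈ S)
    (hg : γ[n + 1] ∈ S) (ht : τ[n + 2] ∈ S) (X : Y d (n + 2)) : X ∈ S := by
  refine mem_of_generators (fun _ => ?_) (fun i hi => ?_) (fun j hj => ?_) X
  · rw [← incl_b (by omega)]; exact hι _
  · rcases Nat.lt_or_ge i (n + 1) with h | h
    · rw [← incl_g ⟨hi.1, h⟩]; exact hι _
    · obtain rfl : i = n + 1 := by omega
      exact hg
  · rcases Nat.lt_or_ge j (n + 2) with h | h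
    · rw [← incl_t ⟨hj.1, by omega⟩]; exact hι _
    · obtain rfl : j = n + 2 := by omega
      exact ht

theorem mElt_self {k : ℕ} (s : Bool) (a : ℕ) :
    mElt d n s (k + 1) a (k + 1)
      = if s then bAt d n (k + 1) * t d n (k + 1) ^ a else t d n (k + 1) ^ a := by
  rw [mElt, if_pos rfl]

theorem mElt_succ {j k : ℕ} (s : Bool) (a : ℕ) (h : j ≤ k) :
    mElt d n s j a (k + 1) = g d n k * mElt d n s j a k := by
  rw [mElt, if_neg (by omega)]

theorem incl_mElt {j k : ℕ} (s : Bool) (a : ℕ) (hj : 1 ≤ j) (hk : j ≤ k) (hn : k ≤ n) :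
    ι (mElt d n s j a k) = mElt d (n + 1) s j a k := by
  induction k, hk using Nat.le_induction with
  | base =>
    obtain ⟨j, rfl⟩ := Nat.exists_eq_add_of_le' hj
    cases s <;> simp [mElt_self, incl_bAt (d := d) ⟨hj, hn⟩, incl_t (d := d) ⟨hj, hn⟩]
  | succ k hk ih =>
    rw [mElt_succ _ _ hk, mElt_succ _ _ hk, map_mul, ih (by omega), incl_g ⟨by omega, hn⟩]

/-! ### Commutation rules -/

theorem g_semiconjBy_t {i j : ℕ} (hi : 1 ≤ i ∧ i + 1 ≤ n) (hj : 1 ≤ j ∧ j ≤ n) :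
    SemiconjBy (g d n i) (t d n (Equiv.swap i (i + 1) j)) (t d n j) :=
  (t_mul_g d n i j hi hj).symm

theorem g_semiconjBy_t_succ {i : ℕ} (hi : 1 ≤ i ∧ i + 1 ≤ n) :
    SemiconjBy (g d n i) (t d n (i + 1)) (t d n i) := by
  simpa using g_semiconjBy_t (d := d) hi (j := i) ⟨hi.1, by omega⟩

theorem g_semiconjBy_t_self {i : ℕ} (hi : 1 ≤ i ∧ i + 1 ≤ n) :
    SemiconjBy (g d n i) (t d n i) (t d n (i + 1)) := by
  simpa using g_semiconjBy_t (d := d) hi (j := i + 1) ⟨by omega, hi.2⟩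

theorem t_commute_g {i j : ℕ} (hi : 1 ≤ i ∧ i + 1 ≤ n) (hj : 1 ≤ j ∧ j ≤ n) (h1 : j ≠ i)
    (h2 : j ≠ i + 1) : Commute (t d n j) (g d n i) := by
  have := g_semiconjBy_t (d := d) hi hj
  rw [Equiv.swap_apply_of_ne_of_ne h1 h2] at this
  exact Commute.symm this

theorem isUnit_g {i : ℕ} (hi : 1 ≤ i ∧ i + 1 ≤ n) : IsUnit (g d n i) :=
  (gUnit hi).isUnit

theorem commute_gInv {i : ℕ} (hi : 1 ≤ i ∧ i + 1 ≤ n) {X : Y d n} (h : Commute X (g d n i)) :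
    Commute X (gInv d n i) :=
  Commute.units_inv_right (u := gUnit hi) h

theorem g_semiconjBy_bAt {k : ℕ} (hk : 1 ≤ k ∧ k + 1 ≤ n) :
    SemiconjBy (g d n k) (bAt d n k) (bAt d n (k + 1)) := by
  rw [bAt_succ hk.1, SemiconjBy, mul_assoc _ (gInv d n k), gInv_mul_g d n k hk, mul_one]

theorem t_commute_bAt {j k : ℕ} (hj : 1 ≤ j ∧ j ≤ n) (hk : 1 ≤ k ∧ k ≤ n) :
    Commute (t d n j) (bAt d n k) := by
  obtain ⟨h1, h2⟩ := hk
  induction k, h1 using Nat.le_induction generalizing j with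
  | base => exact t_commute_b hj
  | succ k h1 ih =>
    have hk : 1 ≤ k ∧ k + 1 ≤ n := ⟨h1, h2⟩
    have ht := g_semiconjBy_t (d := d) hk hj
    have hb := g_semiconjBy_bAt (d := d) hk
    refine eq_of_semiconjBy (isUnit_g hk) (ht.mul_right hb) ?_
    rw [(ih (swap_range hk hj) (by omega)).eq]
    exact hb.mul_right ht

theorem g_commute_bAt_of_lt {i k : ℕ} (hi : k + 1 ≤ i ∧ i + 1 ≤ n) (hk : 1 ≤ k) :
    Commute (g d n i) (bAt d n k) := by
  induction k, hk using Nat.le_induction with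
  | base => exact (b_commute_g ⟨by omega, hi.2⟩ (by omega)).symm
  | succ k h1 ih =>
    have h : Commute (g d n i) (g d n k) :=
      g_commute_g ⟨by omega, hi.2⟩ ⟨h1, by omega⟩ (by omega)
    rw [bAt_succ h1]
    exact (h.mul_right (ih (by omega))).mul_right (commute_gInv ⟨h1, by omega⟩ h)

theorem g_commute_bAt_of_gt {i k : ℕ} (hi : 1 ≤ i) (hk : i + 2 ≤ k ∧ k ≤ n) :
    Commute (g d n i) (bAt d n k) := by
  obtain ⟨h1, h2⟩ := hk
  induction k, h1 using Nat.le_induction with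
  | base =>
    have hi0 : 1 ≤ i ∧ i + 1 ≤ n := ⟨hi, by omega⟩
    have hi1 : 1 ≤ i + 1 ∧ i + 1 + 1 ≤ n := ⟨by omega, h2⟩
    have hg : SemiconjBy (g d n (i + 1) * g d n i) (g d n (i + 1)) (g d n i) := by
      rw [SemiconjBy, g_braid hi1 hi0 (Or.inr rfl), mul_assoc]
    have hb : SemiconjBy (g d n (i + 1) * g d n i) (bAt d n i) (bAt d n (i + 2)) :=
      (g_semiconjBy_bAt hi1).mul_left (g_semiconjBy_bAt hi0)
    refine eq_of_semiconjBy ((isUnit_g hi1).mul (isUnit_g hi0)) (hg.mul_right hb) ?_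
    rw [(g_commute_bAt_of_lt ⟨le_rfl, h2⟩ hi).eq]
    exact hb.mul_right hg
  | succ k h1 ih =>
    have h : Commute (g d n i) (g d n k) :=
      g_commute_g ⟨hi, by omega⟩ ⟨by omega, by omega⟩ (by omega)
    rw [bAt_succ (by omega)]
    exact (h.mul_right (ih (by omega))).mul_right (commute_gInv ⟨by omega, by omega⟩ h)

theorem bAt_braid {k : ℕ} (hk : 1 ≤ k) (hn : k + 1 ≤ n) :
    bAt d n k * g d n k * bAt d n k * g d n k = g d n k * bAt d n k * g d n k * bAt d n k := by
  induction k, hk using Nat.le_induction with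
  | base => exact b_braid hn
  | succ k h1 ih =>
    have hk : 1 ≤ k ∧ k + 1 ≤ n := ⟨h1, by omega⟩
    have hk1 : 1 ≤ k + 1 ∧ k + 1 + 1 ≤ n := ⟨by omega, hn⟩
    have hg : SemiconjBy (g d n k * g d n (k + 1)) (g d n k) (g d n (k + 1)) := by
      rw [SemiconjBy, g_braid hk hk1 (Or.inl rfl), mul_assoc]
    have hb : SemiconjBy (g d n k * g d n (k + 1)) (bAt d n k) (bAt d n (k + 1)) :=
      (g_semiconjBy_bAt hk).mul_left (g_commute_bAt_of_lt ⟨le_rfl, hn⟩ h1)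
    refine eq_of_semiconjBy ((isUnit_g hk).mul (isUnit_g hk1))
      (((hb.mul_right hg).mul_right hb).mul_right hg) ?_
    rw [ih (by omega)]
    exact ((hg.mul_right hb).mul_right hg).mul_right hb

/-! ### The last generators -/

theorem t_commute_incl (X : Y d n) : Commute τ[n + 1] (ι X) := by
  have hcent : X ∈ (Subalgebra.centralizer 𝕃 {τ[n + 1]}).comap (incl d n) := by
    refine mem_of_generators (fun h => ?_) (fun i hi => ?_) (fun j hj => ?_) X <;>
      simp only [Subalgebra.mem_comap, Subalgebra.mem_centralizer_iff, Set.mem_singleton_iff,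
        forall_eq]
    · rw [incl_b h]; exact t_commute_b ⟨by omega, le_rfl⟩
    · rw [incl_g hi]
      exact t_commute_g ⟨hi.1, by omega⟩ ⟨by omega, le_rfl⟩ (by omega) (by omega)
    · rw [incl_t hj]; exact t_comm d _ _ _ ⟨by omega, le_rfl⟩ ⟨hj.1, by omega⟩
  exact hcent _ rfl

theorem g_commute_incl_incl (X : Y d n) : Commute γ[n + 1] (ι (ι X)) := by
  have hcent : X ∈
      (Subalgebra.centralizer 𝕃 {γ[n + 1]}).comap ((incl d (n + 1)).comp (incl d n)) := by
    refine mem_of_generators (fun h => ?_) (fun i hi => ?_) (fun j hj => ?_) X <;>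
      simp only [Subalgebra.mem_comap, Subalgebra.mem_centralizer_iff, Set.mem_singleton_iff,
        forall_eq, AlgHom.comp_apply]
    · rw [incl_b h, incl_b (by omega)]
      exact (b_commute_g ⟨by omega, le_rfl⟩ (by omega)).symm
    · rw [incl_g hi, incl_g ⟨hi.1, by omega⟩]
      exact g_commute_g ⟨by omega, le_rfl⟩ ⟨hi.1, by omega⟩ (by omega)
    · rw [incl_t hj, incl_t ⟨hj.1, by omega⟩]
      exact (t_commute_g ⟨by omega, le_rfl⟩ ⟨hj.1, by omega⟩ (by omega) (by omega)).symm
  exact hcent _ rfl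

theorem incl_t_last : ι τ[n + 1] = t d (n + 2) (n + 1) := incl_t ⟨by omega, le_rfl⟩

theorem incl_bAt_last : ι β[n + 1] = bAt d (n + 2) (n + 1) := incl_bAt ⟨by omega, le_rfl⟩

theorem g_mul_gInv_last : γ[n + 1] * γ⁻¹[n + 1] = 1 := g_mul_gInv _ _ _ ⟨by omega, le_rfl⟩

theorem gInv_mul_g_last : γ⁻¹[n + 1] * γ[n + 1] = 1 := gInv_mul_g _ _ _ ⟨by omega, le_rfl⟩

theorem g_mul_t_pow (a : ℕ) : γ[n + 1] * τ[n + 2] ^ a = ι (τ[n + 1] ^ a) * γ[n + 1] := by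
  rw [map_pow, incl_t_last]
  exact ((g_semiconjBy_t_succ ⟨by omega, le_rfl⟩).pow_right a).eq

theorem t_pow_mul_g (a : ℕ) : τ[n + 2] ^ a * γ[n + 1] = γ[n + 1] * ι (τ[n + 1] ^ a) := by
  rw [map_pow, incl_t_last]
  exact ((g_semiconjBy_t_self ⟨by omega, le_rfl⟩).pow_right a).eq.symm

theorem bAt_mul_g : β[n + 2] * γ[n + 1] = γ[n + 1] * ι β[n + 1] := by
  rw [incl_bAt_last]; exact (g_semiconjBy_bAt ⟨by omega, le_rfl⟩).eq.symm

theorem bAt_eq_conj : β[n + 2] = γ[n + 1] * ι β[n + 1] * γ⁻¹[n + 1] := by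
  rw [← bAt_mul_g, mul_assoc, g_mul_gInv_last, mul_one]

theorem t_pow_mul_incl (a : ℕ) (X : Y d n) : τ[n + 1] ^ a * ι X = ι X * τ[n + 1] ^ a :=
  ((t_commute_incl X).pow_left a).eq

theorem t_pow_mul_incl_assoc (a : ℕ) (X : Y d n) (Z : Y d (n + 1)) :
    τ[n + 1] ^ a * (ι X * Z) = ι X * (τ[n + 1] ^ a * Z) := by
  rw [← mul_assoc, t_pow_mul_incl, mul_assoc]

theorem t_pow_mul_bAt (a : ℕ) : τ[n + 1] ^ a * β[n + 1] = β[n + 1] * τ[n + 1] ^ a :=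
  ((t_commute_bAt ⟨by omega, le_rfl⟩ ⟨by omega, le_rfl⟩).pow_left a).eq

theorem g_mul_incl_incl (W : Y d n) : γ[n + 1] * ι (ι W) = ι (ι W) * γ[n + 1] :=
  (g_commute_incl_incl W).eq

theorem gInv_last_eq_sub_sum :
    γ⁻¹[n + 1] = γ[n + 1] - κ • ∑ m ∈ range d, ι (τ[n + 1] ^ m) * τ[n + 2] ^ (d - m) := by
  rw [gInv_eq_sub_sum]; simp only [map_pow, incl_t_last]

theorem g_mul_incl_mul_g (Z : Y d (n + 1)) :
    γ[n + 1] * ι Z * γ[n + 1] = γ[n + 1] * ι Z * γ⁻¹[n + 1]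
      + κ • ∑ m ∈ range d, ι (τ[n + 1] ^ (d - m)) * γ[n + 1] * ι (Z * τ[n + 1] ^ m) := by
  have hsum : ∑ m ∈ range d, ι (τ[n + 1] ^ (d - m)) * γ[n + 1] * ι (Z * τ[n + 1] ^ m)
      = γ[n + 1] * ι Z * ∑ m ∈ range d, ι (τ[n + 1] ^ m) * τ[n + 2] ^ (d - m) := by
    rw [mul_sum]
    refine sum_congr rfl fun m _ => ?_
    rw [← g_mul_t_pow, mul_assoc, t_pow_mul_incl, map_mul]
    simp only [mul_assoc]
  rw [hsum, gInv_last_eq_sub_sum, mul_sub, mul_smul_comm, sub_add_cancel]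

theorem g_mul_incl_t_pow_mul_gInv (a : ℕ) :
    γ[n + 1] * ι (τ[n + 1] ^ a) * γ⁻¹[n + 1] = τ[n + 2] ^ a := by
  rw [← t_pow_mul_g, mul_assoc, g_mul_gInv_last, mul_one]

theorem g_mul_incl_bAt_mul_gInv (a : ℕ) :
    γ[n + 1] * ι (β[n + 1] * τ[n + 1] ^ a) * γ⁻¹[n + 1] = β[n + 2] * τ[n + 2] ^ a := by
  rw [map_mul, ← mul_assoc, ← bAt_mul_g, mul_assoc β[n + 2], ← t_pow_mul_g, mul_assoc β[n + 2],
    mul_assoc, g_mul_gInv_last, mul_one]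

theorem bAt_braid_last : ι β[n + 1] * γ[n + 1] * ι β[n + 1] * γ[n + 1]
    = γ[n + 1] * ι β[n + 1] * γ[n + 1] * ι β[n + 1] := by
  rw [incl_bAt_last]; exact bAt_braid (by omega) le_rfl

theorem bAt_commutator : β[n + 2] * ι β[n + 1] - ι β[n + 1] * β[n + 2]
    = κ • ∑ m ∈ range d,
      (ι (β[n + 1] * τ[n + 1] ^ m) * γ[n + 1] * ι (τ[n + 1] ^ (d - m) * β[n + 1])
        - ι (τ[n + 1] ^ (d - m)) * γ[n + 1] * ι (τ[n + 1] ^ m * (β[n + 1] * β[n + 1]))) := by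
  have hleft : ι β[n + 1] * β[n + 2] = γ⁻¹[n + 1] * ι β[n + 1] * γ[n + 1] * ι β[n + 1] := by
    have := congrArg (fun Z => γ⁻¹[n + 1] * Z * γ⁻¹[n + 1]) (bAt_braid_last (d := d) (n := n))
    simp only [mul_assoc, g_mul_gInv_last, mul_one] at this
    simp only [← mul_assoc, gInv_mul_g_last, one_mul] at this
    rw [bAt_eq_conj, this]
    simp only [← mul_assoc]
  rw [hleft, bAt_eq_conj, gInv_last_eq_sub_sum]
  simp only [mul_sub, sub_mul, mul_smul_comm, smul_mul_assoc, mul_sum, sum_mul,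
    sum_sub_distrib, smul_sub]
  rw [sub_sub_sub_cancel_left]
  congr 2
  · refine sum_congr rfl fun m _ => ?_
    rw [← t_pow_mul_bAt, map_mul, map_mul]
    simp only [mul_assoc]
    rw [← mul_assoc (τ[n + 2] ^ _), t_pow_mul_incl, ← mul_assoc γ[n + 1] (ι _), ← t_pow_mul_g]
    simp only [mul_assoc]
  · refine sum_congr rfl fun m _ => ?_
    rw [← g_mul_t_pow, ← mul_assoc (τ[n + 1] ^ m), t_pow_mul_bAt]
    simp only [map_mul, mul_assoc, t_pow_mul_incl, t_pow_mul_incl_assoc]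

/-! ### The decomposition of `Yₙ₊₁` over `Yₙ` -/

/-- The subbimodule `Yₙ gₙ Yₙ` of `Yₙ₊₁`; it is zero for `n = 0`. -/
def gBimodule (d n : ℕ) : Submodule 𝕃 (Y d (n + 1)) :=
  Submodule.span 𝕃 {X | 1 ≤ n ∧ ∃ A C : Y d n, X = incl d n A * g d (n + 1) n * incl d n C}

theorem incl_mul_g_mul_incl_mem (A C : Y d (n + 1)) :
    ι A * γ[n + 1] * ι C ∈ gBimodule d (n + 1) :=
  Submodule.subset_span ⟨by omega, A, C, rfl⟩

theorem gBimodule_induction {p : Submodule 𝕃 (Y d (n + 2))}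
    (h : ∀ A C : Y d (n + 1), ι A * γ[n + 1] * ι C ∈ p) : gBimodule d (n + 1) ≤ p :=
  Submodule.span_le.mpr fun _ ⟨_, A, C, hX⟩ => hX ▸ h A C

theorem gBimodule_zero : gBimodule d 0 = ⊥ :=
  Submodule.span_eq_bot.mpr fun _ hX => absurd hX.1 (by omega)

theorem incl_mul_mem_gBimodule (W : Y d n) {X : Y d (n + 1)} (hX : X ∈ gBimodule d n) :
    ι W * X ∈ gBimodule d n := by
  have hle : gBimodule d n ≤ (gBimodule d n).comap (LinearMap.mulLeft 𝕃 (ι W)) := by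
    refine Submodule.span_le.mpr ?_
    rintro _ ⟨hn, A, C, rfl⟩
    exact Submodule.subset_span ⟨hn, W * A, C, by simp [mul_assoc]⟩
  exact hle hX

theorem mul_incl_mem_gBimodule (W : Y d n) {X : Y d (n + 1)} (hX : X ∈ gBimodule d n) :
    X * ι W ∈ gBimodule d n := by
  have hle : gBimodule d n ≤ (gBimodule d n).comap (LinearMap.mulRight 𝕃 (ι W)) := by
    refine Submodule.span_le.mpr ?_
    rintro _ ⟨hn, A, C, rfl⟩
    exact Submodule.subset_span ⟨hn, A, C * W, by simp [mul_assoc]⟩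
  exact hle hX

theorem incl_mul_g_mul_incl_mul_t_pow (A C : Y d (n + 1)) (a : ℕ) :
    ι A * γ[n + 1] * ι C * τ[n + 2] ^ a = ι (A * τ[n + 1] ^ a) * γ[n + 1] * ι C := by
  rw [mul_assoc, ← t_pow_mul_incl, ← mul_assoc, mul_assoc (ι A), g_mul_t_pow, map_mul]
  simp only [mul_assoc]

theorem mul_t_pow_mem_gBimodule (a : ℕ) {X : Y d (n + 1)} (hX : X ∈ gBimodule d n) :
    X * τ[n + 1] ^ a ∈ gBimodule d n := by
  obtain _ | n := n
  · rw [gBimodule_zero, Submodule.mem_bot] at hX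
    rw [hX, zero_mul]; exact zero_mem _
  · refine gBimodule_induction
      (p := (gBimodule d (n + 1)).comap (LinearMap.mulRight 𝕃 (τ[n + 2] ^ a))) (fun A C => ?_) hX
    rw [Submodule.mem_comap, LinearMap.mulRight_apply, incl_mul_g_mul_incl_mul_t_pow]
    exact incl_mul_g_mul_incl_mem _ _

theorem bAt_commutator_mem {K : Submodule 𝕃 (Y d (n + 1))} (hl : ∀ W : Y d n, ∀ X ∈ K, ι W * X ∈ K)
    (hr : ∀ W : Y d n, ∀ X ∈ K, X * ι W ∈ K)
    (hb : 1 ≤ n → β[n + 1] * ι β[n] - ι β[n] * β[n + 1] ∈ K) (W : Y d n) :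
    β[n + 1] * ι W - ι W * β[n + 1] ∈ K := by
  have of_commute {X : Y d (n + 1)} (hX : Commute X β[n + 1]) :
      β[n + 1] * X - X * β[n + 1] ∈ K := by
    rw [hX.eq, sub_self]; exact zero_mem _
  refine mem_of_generators_last (S := commutantMod (incl d n) β[n + 1] K hl hr) hb
    (fun i hi => of_commute ?_) (fun j hj => of_commute ?_) W
  · rw [incl_g hi]; exact g_commute_bAt_of_gt hi.1 ⟨by omega, le_rfl⟩
  · rw [incl_t hj]; exact t_commute_bAt ⟨hj.1, by omega⟩ ⟨by omega, le_rfl⟩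

theorem bAt_commutator_mem_gBimodule (W : Y d n) :
    β[n + 1] * ι W - ι W * β[n + 1] ∈ gBimodule d n := by
  refine bAt_commutator_mem (fun W _ => incl_mul_mem_gBimodule W)
    (fun W _ => mul_incl_mem_gBimodule W) (fun hn => ?_) W
  obtain ⟨n, rfl⟩ := Nat.exists_eq_add_of_le' hn
  rw [bAt_commutator]
  exact Submodule.smul_mem _ _ (Submodule.sum_mem _ fun m _ =>
    Submodule.sub_mem _ (incl_mul_g_mul_incl_mem _ _) (incl_mul_g_mul_incl_mem _ _))

/-- The elements `w tᵃ`, `w b tᵃ` and `w gₙ w'` of `Yₙ₊₁`, with `w, w'` in `Yₙ` and the last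
generators `t = tₙ₊₁` and `b = bₙ₊₁`. -/
def spanningSet (d n : ℕ) : Set (Y d (n + 1)) :=
  {X | (∃ W a, X = incl d n W * t d (n + 1) (n + 1) ^ a) ∨
    (∃ W a, X = incl d n W * (bAt d (n + 1) (n + 1) * t d (n + 1) (n + 1) ^ a)) ∨
    (1 ≤ n ∧ ∃ A C : Y d n, X = incl d n A * g d (n + 1) n * incl d n C)}

theorem gBimodule_le_span : gBimodule d n ≤ Submodule.span 𝕃 (spanningSet d n) :=
  Submodule.span_mono fun _ h => Or.inr (Or.inr h)

theorem incl_mul_t_pow_mem_span (W : Y d n) (a : ℕ) :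
    ι W * τ[n + 1] ^ a ∈ Submodule.span 𝕃 (spanningSet d n) :=
  Submodule.subset_span (Or.inl ⟨W, a, rfl⟩)

theorem incl_mul_bAt_mem_span (W : Y d n) (a : ℕ) :
    ι W * (β[n + 1] * τ[n + 1] ^ a) ∈ Submodule.span 𝕃 (spanningSet d n) :=
  Submodule.subset_span (Or.inr (Or.inl ⟨W, a, rfl⟩))

theorem incl_mul_mem_span (V : Y d n) {X : Y d (n + 1)}
    (hX : X ∈ Submodule.span 𝕃 (spanningSet d n)) :
    ι V * X ∈ Submodule.span 𝕃 (spanningSet d n) := by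
  have hle : Submodule.span 𝕃 (spanningSet d n)
      ≤ (Submodule.span 𝕃 (spanningSet d n)).comap (LinearMap.mulLeft 𝕃 (ι V)) := by
    refine Submodule.span_le.mpr ?_
    rintro _ (⟨W, a, rfl⟩ | ⟨W, a, rfl⟩ | ⟨hn, A, C, rfl⟩)
    · exact Submodule.subset_span (Or.inl ⟨V * W, a, by simp [mul_assoc]⟩)
    · exact Submodule.subset_span (Or.inr (Or.inl ⟨V * W, a, by simp [mul_assoc]⟩))
    · exact Submodule.subset_span (Or.inr (Or.inr ⟨hn, V * A, C, by simp [mul_assoc]⟩))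
  exact hle hX

theorem incl_mem_rightStabilizer (V : Y d n) :
    ι V ∈ rightStabilizer (Submodule.span 𝕃 (spanningSet d n)) := by
  refine mem_rightStabilizer_span ?_
  rintro _ (⟨W, a, rfl⟩ | ⟨W, a, rfl⟩ | ⟨hn, A, C, rfl⟩)
  · rw [mul_assoc, t_pow_mul_incl, ← mul_assoc, ← map_mul]
    exact incl_mul_t_pow_mem_span _ _
  · have hsplit : ι W * (β[n + 1] * τ[n + 1] ^ a) * ι V
        = ι (W * V) * (β[n + 1] * τ[n + 1] ^ a)
          + ι W * (β[n + 1] * ι V - ι V * β[n + 1]) * τ[n + 1] ^ a := by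
      rw [mul_assoc, mul_assoc, t_pow_mul_incl, map_mul]
      noncomm_ring
    rw [hsplit]
    exact add_mem (incl_mul_bAt_mem_span _ a) (gBimodule_le_span (mul_t_pow_mem_gBimodule a
      (incl_mul_mem_gBimodule W (bAt_commutator_mem_gBimodule V))))
  · exact gBimodule_le_span (mul_incl_mem_gBimodule V (Submodule.subset_span ⟨hn, A, C, rfl⟩))

theorem t_mem_rightStabilizer :
    τ[n + 1] ∈ rightStabilizer (Submodule.span 𝕃 (spanningSet d n)) := by
  refine mem_rightStabilizer_span ?_
  rintro _ (⟨W, a, rfl⟩ | ⟨W, a, rfl⟩ | ⟨hn, A, C, rfl⟩)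
  · rw [mul_assoc, ← pow_succ]
    exact incl_mul_t_pow_mem_span _ _
  · rw [mul_assoc, mul_assoc, ← pow_succ]
    exact incl_mul_bAt_mem_span _ _
  · rw [← pow_one (t d _ _)]
    exact gBimodule_le_span (mul_t_pow_mem_gBimodule 1 (Submodule.subset_span ⟨hn, A, C, rfl⟩))

theorem b_mem_rightStabilizer :
    b d 1 ∈ rightStabilizer (Submodule.span 𝕃 (spanningSet d 0)) := by
  have hcomm (a : ℕ) : t d 1 1 ^ a * b d 1 = b d 1 * t d 1 1 ^ a :=
    ((t_commute_b ⟨le_rfl, le_rfl⟩).pow_left a).eq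
  refine mem_rightStabilizer_span ?_
  rintro _ (⟨W, a, rfl⟩ | ⟨W, a, rfl⟩ | ⟨hn, A, C, rfl⟩)
  · rw [mul_assoc, hcomm]
    exact incl_mul_bAt_mem_span W a
  · change ι W * (b d 1 * t d 1 1 ^ a) * b d 1 ∈ _
    have hb : b d 1 * b d 1 * t d 1 1 ^ a = t d 1 1 ^ a
        + (pv - pv⁻¹) • (d : 𝕃)⁻¹ • ∑ m ∈ range d, b d 1 * t d 1 1 ^ (m + a) := by
      rw [b_mul_b le_rfl]
      simp only [add_mul, one_mul, smul_mul_assoc, sum_mul, hcomm, pow_add, mul_assoc]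
    rw [mul_assoc, mul_assoc, hcomm, ← mul_assoc (b d 1), hb]
    simp only [mul_add, mul_smul_comm, mul_sum]
    exact add_mem (incl_mul_t_pow_mem_span W a) (Submodule.smul_mem _ _ (Submodule.smul_mem _ _
      (Submodule.sum_mem _ fun m _ => incl_mul_bAt_mem_span W (m + a))))
  · omega

theorem g_mul_incl_gBimodule_mul_g (A C : Y d (n + 1)) :
    γ[n + 2] * ι (ι A * γ[n + 1] * ι C) * γ[n + 2]
      = ι (ι A * γ[n + 1]) * γ[n + 2] * ι (γ[n + 1] * ι C) := by
  have hbraid : γ[n + 2] * ι γ[n + 1] * γ[n + 2] = ι γ[n + 1] * γ[n + 2] * ι γ[n + 1] := by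
    rw [incl_g ⟨by omega, by omega⟩]
    exact g_braid ⟨by omega, by omega⟩ ⟨by omega, by omega⟩ (Or.inr rfl)
  calc γ[n + 2] * ι (ι A * γ[n + 1] * ι C) * γ[n + 2]
      = γ[n + 2] * ι (ι A) * ι γ[n + 1] * (ι (ι C) * γ[n + 2]) := by
        simp only [map_mul, mul_assoc]
    _ = ι (ι A) * (γ[n + 2] * ι γ[n + 1] * γ[n + 2]) * ι (ι C) := by
        rw [g_mul_incl_incl A, ← g_mul_incl_incl C]; simp only [mul_assoc]
    _ = _ := by rw [hbraid]; simp only [map_mul, mul_assoc]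

theorem g_mul_incl_mul_g_mem_span (h : Submodule.span 𝕃 (spanningSet d n) = ⊤) (C : Y d (n + 1)) :
    γ[n + 1] * ι C * γ[n + 1] ∈ Submodule.span 𝕃 (spanningSet d (n + 1)) := by
  have of_conj (W : Y d n) (Z : Y d (n + 1))
      (hZ : γ[n + 1] * ι Z * γ⁻¹[n + 1] ∈ Submodule.span 𝕃 (spanningSet d (n + 1))) :
      γ[n + 1] * ι (ι W * Z) * γ[n + 1] ∈ Submodule.span 𝕃 (spanningSet d (n + 1)) := by
    rw [map_mul, ← mul_assoc, g_mul_incl_incl, mul_assoc, mul_assoc, ← mul_assoc γ[n + 1],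
      g_mul_incl_mul_g]
    exact incl_mul_mem_span _ (add_mem hZ (gBimodule_le_span (Submodule.smul_mem _ _
      (Submodule.sum_mem _ fun m _ => incl_mul_g_mul_incl_mem _ _))))
  have hle : Submodule.span 𝕃 (spanningSet d n) ≤ (Submodule.span 𝕃 (spanningSet d (n + 1))).comap
      ((LinearMap.mulLeftRight 𝕃 (γ[n + 1], γ[n + 1])).comp (incl d (n + 1)).toLinearMap) := by
    refine Submodule.span_le.mpr ?_
    rintro _ (⟨W, a, rfl⟩ | ⟨W, a, rfl⟩ | ⟨hn, A, C, rfl⟩)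
    · refine of_conj W _ ?_
      rw [g_mul_incl_t_pow_mul_gInv]
      simpa only [map_one, one_mul] using incl_mul_t_pow_mem_span (d := d) (n := n + 1) 1 a
    · refine of_conj W _ ?_
      rw [g_mul_incl_bAt_mul_gInv]
      simpa only [map_one, one_mul] using incl_mul_bAt_mem_span (d := d) (n := n + 1) 1 a
    · obtain ⟨n, rfl⟩ := Nat.exists_eq_add_of_le' hn
      rw [SetLike.mem_coe, Submodule.mem_comap, LinearMap.comp_apply, LinearMap.mulLeftRight_apply,
        AlgHom.toLinearMap_apply, g_mul_incl_gBimodule_mul_g]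
      exact gBimodule_le_span (incl_mul_g_mul_incl_mem _ _)
  exact hle (h ▸ Submodule.mem_top : C ∈ _)

theorem g_mem_rightStabilizer (h : Submodule.span 𝕃 (spanningSet d n) = ⊤) :
    γ[n + 1] ∈ rightStabilizer (Submodule.span 𝕃 (spanningSet d (n + 1))) := by
  refine mem_rightStabilizer_span ?_
  rintro _ (⟨W, a, rfl⟩ | ⟨W, a, rfl⟩ | ⟨_, A, C, rfl⟩)
  · rw [mul_assoc, t_pow_mul_g, ← mul_assoc]
    exact gBimodule_le_span (incl_mul_g_mul_incl_mem _ _)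
  · rw [mul_assoc, mul_assoc, t_pow_mul_g, ← mul_assoc β[n + 2], bAt_mul_g, mul_assoc, ← map_mul,
      ← mul_assoc]
    exact gBimodule_le_span (incl_mul_g_mul_incl_mem _ _)
  · rw [mul_assoc, mul_assoc, ← mul_assoc γ[n + 1]]
    exact incl_mul_mem_span A (g_mul_incl_mul_g_mem_span h C)

theorem span_spanningSet (d n : ℕ) : Submodule.span 𝕃 (spanningSet d n) = ⊤ := by
  have one_mem (n : ℕ) : (1 : Y d (n + 1)) ∈ Submodule.span 𝕃 (spanningSet d n) := by
    simpa using incl_mul_t_pow_mem_span (d := d) (n := n) 1 0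
  induction n with
  | zero =>
    refine eq_top_of_one_mem (one_mem 0) (mem_of_generators (fun _ => b_mem_rightStabilizer)
      (fun i hi => by omega) fun j hj => ?_)
    obtain rfl : j = 1 := by omega
    exact t_mem_rightStabilizer
  | succ n ih =>
    exact eq_top_of_one_mem (one_mem _) (mem_of_last_generators incl_mem_rightStabilizer
      (g_mem_rightStabilizer ih) t_mem_rightStabilizer)

@[elab_as_elim]
theorem succ_induction {p : Y d (n + 1) → Prop} (t_pow : ∀ W a, p (ι W * τ[n + 1] ^ a))
    (bAt_t_pow : ∀ W a, p (ι W * (β[n + 1] * τ[n + 1] ^ a))) (gBimodule : ∀ X ∈ gBimodule d n, p X)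
    (add : ∀ X X', p X → p X' → p (X + X')) (X : Y d (n + 1)) : p X := by
  have hX : X ∈ Submodule.span 𝕃 (spanningSet d n) := span_spanningSet d n ▸ Submodule.mem_top
  refine Submodule.closure_induction (p := fun X _ => p X) ?_ (fun X X' _ _ => add X X') ?_ hX
  · exact gBimodule 0 (zero_mem _)
  · rintro c _ (⟨W, a, rfl⟩ | ⟨W, a, rfl⟩ | ⟨hn, A, C, rfl⟩)
    · simpa only [map_smul, smul_mul_assoc] using t_pow (c • W) a
    · simpa only [map_smul, smul_mul_assoc] using bAt_t_pow (c • W) a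
    · exact gBimodule _ (Submodule.smul_mem _ c (Submodule.subset_span ⟨hn, A, C, rfl⟩))

/-! ### The representation on framed signed permutations -/

/-- Signed permutations of `Fin n`, where `true` is the positive sign, with a colour in `Fin d` at
each position. They index a basis of a cyclic representation of `Y_{d,n}^B`. -/
abbrev FramedPerm (d n : ℕ) : Type := Equiv.Perm (Fin n) × (Fin n → Bool) × (Fin n → Fin d)

namespace FramedPerm

/-- The signed value, in `±{1, …, n}`, at a position. -/
def value (w : FramedPerm d n) (i : Fin n) : ℤ :=
  if w.2.1 i then (w.1 i : ℤ) + 1 else -((w.1 i : ℤ) + 1)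

/-- The colour at a position. -/
def colour (w : FramedPerm d n) (i : Fin n) : Fin d := w.2.2 i

/-- Permutation of the positions. -/
def permute (π : Equiv.Perm (Fin n)) (w : FramedPerm d n) : FramedPerm d n :=
  (w.1 * π, w.2.1 ∘ π, w.2.2 ∘ π)

/-- Change of sign at a position. -/
def negate (i : Fin n) (w : FramedPerm d n) : FramedPerm d n :=
  (w.1, Function.update w.2.1 i (!w.2.1 i), w.2.2)

@[simp] theorem value_permute (π : Equiv.Perm (Fin n)) (w : FramedPerm d n) (i : Fin n) :
    (w.permute π).value i = w.value (π i) := rfl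

@[simp] theorem colour_permute (π : Equiv.Perm (Fin n)) (w : FramedPerm d n) (i : Fin n) :
    (w.permute π).colour i = w.colour (π i) := rfl

@[simp] theorem colour_negate (w : FramedPerm d n) (i j : Fin n) :
    (w.negate i).colour j = w.colour j := rfl

@[simp] theorem value_negate_self (w : FramedPerm d n) (i : Fin n) :
    (w.negate i).value i = -w.value i := by
  simp only [value, negate, Function.update_self]
  cases w.2.1 i <;> simp

theorem value_negate_of_ne (w : FramedPerm d n) {i j : Fin n} (h : j ≠ i) :
    (w.negate i).value j = w.value j := by
  simp [value, negate, h]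

theorem permute_permute (π ρ : Equiv.Perm (Fin n)) (w : FramedPerm d n) :
    (w.permute ρ).permute π = w.permute (ρ * π) := rfl

theorem permute_one (w : FramedPerm d n) : w.permute 1 = w := rfl

theorem permute_swap_permute_swap (i j : Fin n) (w : FramedPerm d n) :
    (w.permute (Equiv.swap i j)).permute (Equiv.swap i j) = w := by
  rw [permute_permute, Equiv.swap_mul_self, permute_one]

theorem negate_negate (i : Fin n) (w : FramedPerm d n) : (w.negate i).negate i = w := by
  obtain ⟨σ, s, c⟩ := w
  simp [negate]

theorem negate_permute (i : Fin n) (π : Equiv.Perm (Fin n)) (w : FramedPerm d n) :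
    (w.permute π).negate i = (w.negate (π i)).permute π := by
  obtain ⟨σ, s, c⟩ := w
  simp only [negate, permute, Prod.mk.injEq, true_and, and_true]
  ext j
  by_cases h : j = i
  · subst h; simp
  · simp [h]

theorem negate_comm (i j : Fin n) (w : FramedPerm d n) :
    (w.negate j).negate i = (w.negate i).negate j := by
  rcases eq_or_ne i j with rfl | h
  · rfl
  · obtain ⟨σ, s, c⟩ := w
    simp [negate, h, h.symm, Function.update_comm h]

theorem value_ne_zero (w : FramedPerm d n) (i : Fin n) : w.value i ≠ 0 := by
  unfold value; split_ifs <;> omega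

theorem value_ne (w : FramedPerm d n) {i j : Fin n} (h : i ≠ j) :
    w.value i ≠ w.value j ∧ w.value i ≠ -w.value j := by
  have : (w.1 i : ℕ) ≠ w.1 j := fun h' => h (w.1.injective (Fin.ext h'))
  unfold value; split_ifs <;> omega

end FramedPerm

open FramedPerm

section Operators
variable {K : Type*} [CommRing K] (q r ζ : K)

/-- The diagonal coefficient of `braidOp` on adjacent letters of colours `c`, `c'` and signed
values `x`, `x'`. -/
def braidCoeff (c c' : Fin d) (x x' : ℤ) : K := if c = c' ∧ x < x' then q else 0

/-- The diagonal coefficient of `loopOp` on a letter of colour `c` and signed value `x`. -/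
def loopCoeff (c : Fin d) (x : ℤ) : K := if (c : ℕ) = 0 ∧ 0 < x then r else 0

/-- The operator of a braid generator: it exchanges two positions, with a Hecke correction when
the two letters have the same colour. -/
def braidOp (i j : Fin n) : Module.End K (FramedPerm d n → K) where
  toFun F w := F (w.permute (Equiv.swap i j))
    + braidCoeff q (w.colour i) (w.colour j) (w.value i) (w.value j) * F w
  map_add' F F' := by ext w; simp only [Pi.add_apply]; ring
  map_smul' c F := by ext w; simp only [Pi.smul_apply, smul_eq_mul, RingHom.id_apply]; ring

/-- The operator of the loop generator: it changes the sign at a position, with a Hecke correction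
when the letter has colour `0`. -/
def loopOp (i : Fin n) : Module.End K (FramedPerm d n → K) where
  toFun F w := F (w.negate i) + loopCoeff r (w.colour i) (w.value i) * F w
  map_add' F F' := by ext w; simp only [Pi.add_apply]; ring
  map_smul' c F := by ext w; simp only [Pi.smul_apply, smul_eq_mul, RingHom.id_apply]; ring

/-- The operator of a framing generator: it is diagonal with eigenvalues `ζ ^ colour`. -/
def framingOp (j : Fin n) : Module.End K (FramedPerm d n → K) where
  toFun F w := ζ ^ (w.colour j : ℕ) * F w
  map_add' F F' := by ext w; simp only [Pi.add_apply]; ring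
  map_smul' c F := by ext w; simp only [Pi.smul_apply, smul_eq_mul, RingHom.id_apply]; ring

theorem braidOp_apply (i j : Fin n) (F : FramedPerm d n → K) (w : FramedPerm d n) :
    braidOp q i j F w = F (w.permute (Equiv.swap i j))
      + braidCoeff q (w.colour i) (w.colour j) (w.value i) (w.value j) * F w := rfl

theorem loopOp_apply (i : Fin n) (F : FramedPerm d n → K) (w : FramedPerm d n) :
    loopOp r i F w = F (w.negate i) + loopCoeff r (w.colour i) (w.value i) * F w := rfl

theorem framingOp_apply (j : Fin n) (F : FramedPerm d n → K) (w : FramedPerm d n) :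
    framingOp ζ j F w = ζ ^ (w.colour j : ℕ) * F w := rfl

theorem framingOp_pow_apply (j : Fin n) (m : ℕ) (F : FramedPerm d n → K) (w : FramedPerm d n) :
    (framingOp ζ j ^ m) F w = (ζ ^ (w.colour j : ℕ)) ^ m * F w := by
  induction m generalizing F with
  | zero => simp
  | succ m ih => rw [pow_succ, Module.End.mul_apply, ih, framingOp_apply]; ring

theorem swap_commute_swap {i j k l : Fin n} (hik : i ≠ k) (hil : i ≠ l) (hjk : j ≠ k)
    (hjl : j ≠ l) : Commute (Equiv.swap i j) (Equiv.swap k l) := by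
  refine (Equiv.Perm.disjoint_iff_eq_or_eq.mpr fun x => ?_).commute
  by_cases hi : x = i
  · right; exact Equiv.swap_apply_of_ne_of_ne (hi ▸ hik) (hi ▸ hil)
  by_cases hj : x = j
  · right; exact Equiv.swap_apply_of_ne_of_ne (hj ▸ hjk) (hj ▸ hjl)
  · left; exact Equiv.swap_apply_of_ne_of_ne hi hj

theorem braidOp_commute {i j k l : Fin n} (hik : i ≠ k) (hil : i ≠ l) (hjk : j ≠ k) (hjl : j ≠ l) :
    Commute (braidOp (d := d) q i j) (braidOp q k l) := by
  refine LinearMap.ext fun F => funext fun w => ?_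
  simp only [Module.End.mul_apply, braidOp_apply, permute_permute, value_permute, colour_permute,
    (swap_commute_swap hik hil hjk hjl).eq,
    Equiv.swap_apply_of_ne_of_ne hik hil, Equiv.swap_apply_of_ne_of_ne hjk hjl,
    Equiv.swap_apply_of_ne_of_ne hik.symm hjk.symm, Equiv.swap_apply_of_ne_of_ne hil.symm hjl.symm]
  ring

theorem braidCoeff_braid {c₁ c₂ c₃ : Fin d} {x₁ x₂ x₃ : ℤ} (h₁₂ : x₁ ≠ x₂) (h₂₃ : x₂ ≠ x₃)
    (h₁₃ : x₁ ≠ x₃) :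
    braidCoeff q c₁ c₃ x₁ x₃ * braidCoeff q c₂ c₁ x₂ x₁
        + braidCoeff q c₁ c₂ x₁ x₂ * braidCoeff q c₂ c₃ x₂ x₃
      = braidCoeff q c₂ c₃ x₂ x₃ * braidCoeff q c₁ c₃ x₁ x₃ ∧
    braidCoeff q c₁ c₃ x₁ x₃ * braidCoeff q c₃ c₂ x₃ x₂
        + braidCoeff q c₁ c₂ x₁ x₂ * braidCoeff q c₂ c₃ x₂ x₃
      = braidCoeff q c₁ c₂ x₁ x₂ * braidCoeff q c₁ c₃ x₁ x₃ ∧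
    braidCoeff q c₁ c₂ x₁ x₂ * braidCoeff q c₁ c₂ x₁ x₂ * braidCoeff q c₂ c₃ x₂ x₃
      = braidCoeff q c₁ c₂ x₁ x₂ * (braidCoeff q c₂ c₃ x₂ x₃ * braidCoeff q c₂ c₃ x₂ x₃) := by
  unfold braidCoeff
  refine ⟨?_, ?_, ?_⟩ <;> split_ifs <;> first | omega | ring

theorem braidOp_braid {i j k : Fin n} (hij : i ≠ j) (hjk : j ≠ k) (hik : i ≠ k) :
    braidOp (d := d) q i j * braidOp q j k * braidOp q i j
      = braidOp q j k * braidOp q i j * braidOp q j k := by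
  refine LinearMap.ext fun F => funext fun w => ?_
  have hswap : Equiv.swap i j * Equiv.swap j k * Equiv.swap i j
      = Equiv.swap j k * Equiv.swap i j * Equiv.swap j k := by
    rw [Equiv.swap_mul_swap_mul_swap hij hik, Equiv.swap_comm i j, Equiv.swap_comm j k,
      Equiv.swap_mul_swap_mul_swap hjk.symm hik.symm, Equiv.swap_comm]
  obtain ⟨h₁, h₂, h₃⟩ := braidCoeff_braid q (c₁ := w.colour i) (c₂ := w.colour j)
    (c₃ := w.colour k) (w.value_ne hij).1 (w.value_ne hjk).1 (w.value_ne hik).1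
  simp only [Module.End.mul_apply, braidOp_apply, permute_permute, value_permute, colour_permute,
    Equiv.swap_mul_self, permute_one, hswap, Equiv.Perm.mul_apply, Equiv.swap_apply_left,
    Equiv.swap_apply_right, Equiv.swap_apply_of_ne_of_ne hij hik,
    Equiv.swap_apply_of_ne_of_ne hik.symm hjk.symm]
  linear_combination F (w.permute (Equiv.swap i j)) * h₁ - F (w.permute (Equiv.swap j k)) * h₂
    + F w * h₃

theorem loopOp_commute_braidOp {i j k : Fin n} (hij : i ≠ j) (hik : i ≠ k) :
    Commute (loopOp (d := d) r i) (braidOp q j k) := by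
  refine LinearMap.ext fun F => funext fun w => ?_
  simp only [Module.End.mul_apply, braidOp_apply, loopOp_apply, value_permute, colour_permute,
    colour_negate, negate_permute, Equiv.swap_apply_of_ne_of_ne hij hik,
    value_negate_of_ne w hij.symm, value_negate_of_ne w hik.symm]
  ring

theorem braidCoeff_loopCoeff_braid {c c' : Fin d} {x x' : ℤ} (h : x ≠ x') (hneg : x ≠ -x')
    (hx : x ≠ 0) (hx' : x' ≠ 0) :
    braidCoeff q c' c (-x') (-x) = braidCoeff q c c' x x' ∧
    braidCoeff q c c' (-x) x' = braidCoeff q c' c (-x') x ∧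
    loopCoeff r c' x'
        + braidCoeff q c c' (-x) x' * (loopCoeff r c (-x) * braidCoeff q c c' (-x) x')
        + loopCoeff r c x * braidCoeff q c c' x x' * braidCoeff q c c' (-x) x'
      = loopCoeff r c' x' + braidCoeff q c c' x x' * braidCoeff q c c' (-x) x' * loopCoeff r c (-x)
        + braidCoeff q c c' x x' * loopCoeff r c x * braidCoeff q c c' x x' ∧
    loopCoeff r c' x' * braidCoeff q c' c x' (-x) + braidCoeff q c c' (-x) x' * loopCoeff r c (-x)
        + loopCoeff r c x * braidCoeff q c c' x x'
      = braidCoeff q c c' x x' * loopCoeff r c' x' ∧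
    loopCoeff r c x * braidCoeff q c' c (-x') x
      = braidCoeff q c' c (-x') x * loopCoeff r c' (-x')
        + loopCoeff r c' x' * braidCoeff q c' c x' x + braidCoeff q c c' x x' * loopCoeff r c x ∧
    loopCoeff r c x * loopCoeff r c' x' * braidCoeff q c' c x' x
        + loopCoeff r c x * braidCoeff q c c' x x' * loopCoeff r c x
      = loopCoeff r c' x' * braidCoeff q c' c x' x * loopCoeff r c' x'
        + braidCoeff q c c' x x' * loopCoeff r c x * loopCoeff r c' x' := by
  unfold braidCoeff loopCoeff
  refine ⟨?_, ?_, ?_, ?_, ?_, ?_⟩ <;> split_ifs <;> first | omega | ring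

theorem loopOp_braidOp_braid {i j : Fin n} (hij : i ≠ j) :
    loopOp (d := d) r i * braidOp q i j * loopOp r i * braidOp q i j
      = braidOp q i j * loopOp r i * braidOp q i j * loopOp r i := by
  refine LinearMap.ext fun F => funext fun w => ?_
  simp only [Module.End.mul_apply, braidOp_apply, loopOp_apply, value_permute, colour_permute,
    colour_negate, negate_permute, negate_negate, permute_permute, Equiv.swap_mul_self,
    permute_one, Equiv.swap_apply_left, value_negate_self, Equiv.swap_apply_right,
    value_negate_of_ne _ hij, value_negate_of_ne _ hij.symm, negate_comm j i]
  obtain ⟨h₁, h₂, h₃, h₄, h₅, h₆⟩ := braidCoeff_loopCoeff_braid q r (c := w.colour i)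
    (c' := w.colour j) (w.value_ne hij).1 (w.value_ne hij).2 (w.value_ne_zero i)
    (w.value_ne_zero j)
  linear_combination F (((w.negate j).negate i).permute (Equiv.swap i j)) * h₁
    + F (w.permute (Equiv.swap i j)) * (h₂ + h₆) + F (w.negate i) * h₃
    + F ((w.negate i).permute (Equiv.swap i j)) * h₄
    + F ((w.negate j).permute (Equiv.swap i j)) * h₅

theorem framingOp_commute (i j : Fin n) : Commute (framingOp (d := d) ζ i) (framingOp ζ j) := by
  refine LinearMap.ext fun F => funext fun w => ?_
  simp only [Module.End.mul_apply, framingOp_apply]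
  ring

theorem framingOp_commute_loopOp (i j : Fin n) :
    Commute (framingOp (d := d) ζ i) (loopOp r j) := by
  refine LinearMap.ext fun F => funext fun w => ?_
  simp only [Module.End.mul_apply, framingOp_apply, loopOp_apply, colour_negate]
  ring

theorem framingOp_mul_braidOp (i j k : Fin n) :
    framingOp (d := d) ζ k * braidOp q i j
      = braidOp q i j * framingOp ζ (Equiv.swap i j k) := by
  refine LinearMap.ext fun F => funext fun w => ?_
  have hcoeff : braidCoeff q (w.colour i) (w.colour j) (w.value i) (w.value j)
        * ζ ^ (w.colour (Equiv.swap i j k) : ℕ)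
      = braidCoeff q (w.colour i) (w.colour j) (w.value i) (w.value j)
        * ζ ^ (w.colour k : ℕ) := by
    unfold braidCoeff
    split_ifs with h
    · have hk : w.colour (Equiv.swap i j k) = w.colour k := by
        rw [Equiv.swap_apply_def]
        split_ifs with hi hj
        exacts [hi ▸ h.1.symm, hj ▸ h.1, rfl]
      rw [hk]
    · simp only [zero_mul]
  simp only [Module.End.mul_apply, framingOp_apply, braidOp_apply, colour_permute,
    Equiv.swap_apply_self]
  linear_combination -F w * hcoeff

end Operators

section PrimitiveRoot
variable {K : Type*} [Field K] {ζ : K} (hζ : IsPrimitiveRoot ζ d)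
include hζ

theorem framingOp_pow (i : Fin n) : framingOp (d := d) ζ i ^ d = 1 := by
  refine LinearMap.ext fun F => funext fun w => ?_
  rw [framingOp_pow_apply, pow_right_comm, hζ.pow_eq_one, one_pow, one_mul, Module.End.one_apply]

theorem inv_mul_sum_primitiveRoot_pow (a c : Fin d) :
    (d : K)⁻¹ * ∑ m ∈ range d, (ζ ^ (a : ℕ)) ^ m * (ζ ^ (c : ℕ)) ^ (d - m)
      = if a = c then 1 else 0 := by
  have : NeZero d := ⟨a.pos.ne'⟩
  have : NeZero (d : K) := hζ.neZero'
  have hζ0 : ζ ^ (c : ℕ) ≠ 0 := pow_ne_zero _ (hζ.ne_zero (NeZero.ne d))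
  have hζd (k : ℕ) : (ζ ^ k) ^ d = 1 := by rw [pow_right_comm, hζ.pow_eq_one, one_pow]
  have hquot (m : ℕ) (hm : m ∈ range d) :
      (ζ ^ (a : ℕ)) ^ m * (ζ ^ (c : ℕ)) ^ (d - m) = (ζ ^ (a : ℕ) / ζ ^ (c : ℕ)) ^ m := by
    rw [pow_sub₀ _ hζ0 (mem_range.mp hm).le, hζd, one_mul, div_pow, div_eq_mul_inv]
  rw [sum_congr rfl hquot]
  split_ifs with hac
  · rw [hac, div_self hζ0]
    simp [NeZero.ne (d : K)]
  · have hne : ζ ^ (a : ℕ) / ζ ^ (c : ℕ) ≠ 1 := by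
      rw [Ne, div_eq_one_iff_eq hζ0]
      exact fun h => hac (Fin.ext (hζ.pow_inj a.2 c.2 h))
    rw [geom_sum_eq hne, div_pow, hζd, hζd, div_one, sub_self, zero_div, mul_zero]

theorem sum_framingOp_mul_apply (i j : Fin n) (F : FramedPerm d n → K) (w : FramedPerm d n) :
    ((d : K)⁻¹ • ∑ m ∈ range d, framingOp ζ i ^ m * framingOp ζ j ^ (d - m) :
      Module.End K (FramedPerm d n → K)) F w = if w.colour i = w.colour j then F w else 0 := by
  simp only [LinearMap.smul_apply, LinearMap.sum_apply, Module.End.mul_apply, Pi.smul_apply,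
    Finset.sum_apply, framingOp_pow_apply, ← mul_assoc, smul_eq_mul, ← sum_mul,
    inv_mul_sum_primitiveRoot_pow hζ, ite_mul, one_mul, zero_mul]

theorem sum_smul_framingOp_apply (i : Fin n) (c : Fin d) (F : FramedPerm d n → K)
    (w : FramedPerm d n) :
    ((d : K)⁻¹ • ∑ m ∈ range d, (ζ ^ (c : ℕ)) ^ (d - m) • framingOp ζ i ^ m :
      Module.End K (FramedPerm d n → K)) F w = if w.colour i = c then F w else 0 := by
  have hterm (m : ℕ) : (ζ ^ (c : ℕ)) ^ (d - m) * (framingOp ζ i ^ m) F w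
      = (ζ ^ (w.colour i : ℕ)) ^ m * (ζ ^ (c : ℕ)) ^ (d - m) * F w := by
    rw [framingOp_pow_apply]
    ring
  simp only [LinearMap.smul_apply, LinearMap.sum_apply, Pi.smul_apply, Finset.sum_apply,
    smul_eq_mul, hterm, ← sum_mul, ← mul_assoc, inv_mul_sum_primitiveRoot_pow hζ, ite_mul, one_mul,
    zero_mul]

theorem braidOp_sq (q : K) {i j : Fin n} (hij : i ≠ j) :
    braidOp (d := d) q i j ^ 2 = 1 + q •
      (((d : K)⁻¹ • ∑ m ∈ range d, framingOp ζ i ^ m * framingOp ζ j ^ (d - m))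
        * braidOp q i j) := by
  refine LinearMap.ext fun F => funext fun w => ?_
  rw [pow_two, Module.End.mul_apply, LinearMap.add_apply, LinearMap.smul_apply,
    Module.End.mul_apply, Pi.add_apply, Pi.smul_apply, sum_framingOp_mul_apply hζ]
  simp only [braidOp_apply, permute_swap_permute_swap, value_permute, colour_permute,
    Equiv.swap_apply_left, Equiv.swap_apply_right, Module.End.one_apply, smul_eq_mul]
  have hvalue := (w.value_ne hij).1
  unfold braidCoeff
  split_ifs <;> first | omega | ring

theorem loopOp_sq (r : K) (i : Fin n) :
    loopOp (d := d) r i ^ 2 = 1 + r •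
      (((d : K)⁻¹ • ∑ m ∈ range d, framingOp ζ i ^ m) * loopOp r i) := by
  refine LinearMap.ext fun F => funext fun w => ?_
  have : NeZero d := ⟨(w.colour i).pos.ne'⟩
  have hproj := sum_smul_framingOp_apply hζ i 0 (loopOp r i F) w
  simp only [Fin.val_zero, pow_zero, one_pow, one_smul] at hproj
  rw [pow_two, Module.End.mul_apply, LinearMap.add_apply, LinearMap.smul_apply,
    Module.End.mul_apply, Pi.add_apply, Pi.smul_apply, hproj]
  simp only [loopOp_apply, negate_negate, colour_negate, value_negate_self, Module.End.one_apply,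
    smul_eq_mul, ← Fin.val_eq_zero_iff]
  have hvalue := w.value_ne_zero i
  unfold loopCoeff
  split_ifs <;> first | omega | ring

end PrimitiveRoot

/-- The operators attached to the generators of `Y_{d,n}^B`. -/
def repGen (d : ℕ) (ζ : 𝕃) : Gen n → Module.End 𝕃 (FramedPerm d n → 𝕃)
  | .b h => loopOp (pv - pv⁻¹) ⟨0, h⟩
  | .g i h => braidOp (pu - pu⁻¹) ⟨i - 1, by omega⟩ ⟨i, by omega⟩
  | .t j h => framingOp ζ ⟨j - 1, by omega⟩

theorem lift_repGen_fb (ζ : 𝕃) (h : 1 ≤ n) :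
    FreeAlgebra.lift 𝕃 (repGen d ζ) (fb n) = loopOp (pv - pv⁻¹) ⟨0, h⟩ := by
  simp [fb, h, repGen]

theorem lift_repGen_fg (ζ : 𝕃) {i : ℕ} (h : 1 ≤ i ∧ i + 1 ≤ n) :
    FreeAlgebra.lift 𝕃 (repGen d ζ) (fg n i)
      = braidOp (pu - pu⁻¹) ⟨i - 1, by omega⟩ ⟨i, by omega⟩ := by
  simp [fg, h, repGen]

theorem lift_repGen_ft (ζ : 𝕃) {j : ℕ} (h : 1 ≤ j ∧ j ≤ n) :
    FreeAlgebra.lift 𝕃 (repGen d ζ) (ft n j) = framingOp ζ ⟨j - 1, by omega⟩ := by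
  simp [ft, h, repGen]

section Cyclic
variable {ζ : 𝕃} (hζ : IsPrimitiveRoot ζ d)
include hζ

theorem lift_repGen_rel {p q : Free n} (h : Rel d n p q) :
    FreeAlgebra.lift 𝕃 (repGen d ζ) p = FreeAlgebra.lift 𝕃 (repGen d ζ) q := by
  induction h with
  | g_comm i j hi hj hij =>
    simp only [map_mul, lift_repGen_fg ζ hi, lift_repGen_fg ζ hj]
    apply braidOp_commute <;> simp only [ne_eq, Fin.mk.injEq] <;> omega
  | g_braid i j hi hj hij =>
    simp only [map_mul, lift_repGen_fg ζ hi, lift_repGen_fg ζ hj]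
    rcases hij with rfl | rfl
    · apply braidOp_braid <;> simp only [ne_eq, Fin.mk.injEq] <;> omega
    · symm; apply braidOp_braid <;> simp only [ne_eq, Fin.mk.injEq] <;> omega
  | b_g_comm i hi hi1 =>
    simp only [map_mul, lift_repGen_fg ζ hi, lift_repGen_fb ζ (show 1 ≤ n by omega)]
    apply loopOp_commute_braidOp <;> simp only [ne_eq, Fin.mk.injEq] <;> omega
  | b_g_braid hn =>
    simp only [map_mul, lift_repGen_fg ζ ⟨le_rfl, hn⟩, lift_repGen_fb ζ (show 1 ≤ n by omega)]
    apply loopOp_braidOp_braid; simp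
  | t_comm i j hi hj =>
    simp only [map_mul, lift_repGen_ft ζ hi, lift_repGen_ft ζ hj]
    apply framingOp_commute
  | t_g i j hi hj =>
    simp only [map_mul, lift_repGen_fg ζ hi, lift_repGen_ft ζ hj,
      lift_repGen_ft ζ (swap_range hi hj), framingOp_mul_braidOp]
    congr 2
    simp only [Equiv.swap_apply_def, Fin.mk.injEq]
    split_ifs <;> simp only [Fin.mk.injEq] <;> omega
  | t_b j hj =>
    simp only [map_mul, lift_repGen_ft ζ hj, lift_repGen_fb ζ (show 1 ≤ n by omega)]
    apply framingOp_commute_loopOp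
  | t_pow j hj =>
    simp only [map_pow, map_one, lift_repGen_ft ζ hj, framingOp_pow hζ]
  | g_sq i hi =>
    simp only [map_pow, map_mul, map_add, map_one, map_smul, fe, map_sum, lift_repGen_fg ζ hi,
      lift_repGen_ft ζ (show 1 ≤ i ∧ i ≤ n by omega), lift_repGen_ft ζ ⟨i.succ_pos, hi.2⟩]
    apply braidOp_sq hζ; simp only [ne_eq, Fin.mk.injEq]; omega
  | b_sq hn =>
    simp only [map_pow, map_mul, map_add, map_one, map_smul, ff, map_sum, lift_repGen_fb ζ hn,
      lift_repGen_ft ζ (j := 1) ⟨le_rfl, hn⟩]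
    apply loopOp_sq hζ

/-- The representation of `Y_{d,n}^B` on functions on framed signed permutations. -/
def rep (n : ℕ) : Y d n →ₐ[𝕃] Module.End 𝕃 (FramedPerm d n → 𝕃) :=
  RingQuot.liftAlgHom 𝕃 ⟨FreeAlgebra.lift 𝕃 (repGen d ζ), fun _ _ h => lift_repGen_rel hζ h⟩

theorem rep_proj (p : Free n) :
    rep hζ n (proj d n p) = FreeAlgebra.lift 𝕃 (repGen d ζ) p :=
  RingQuot.liftAlgHom_mkAlgHom_apply 𝕃 (FreeAlgebra.lift 𝕃 (repGen d ζ))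
    (fun _ _ h => lift_repGen_rel hζ h) p

omit hζ in
/-- The indicator of the framed permutations whose underlying signed permutation is trivial: a
cyclic vector of `rep`. -/
def cyclicVector (d n : ℕ) : FramedPerm d n → 𝕃 :=
  fun w => if w.1 = 1 ∧ w.2.1 = fun _ => true then 1 else 0

/-- The orbit map `X ↦ X • cyclicVector` of `rep`. -/
def orbitMap (n : ℕ) : Y d n →ₗ[𝕃] (FramedPerm d n → 𝕃) :=
  (LinearMap.applyₗ (cyclicVector d n)).comp (rep hζ n).toLinearMap

theorem rep_apply_mem_range (X : Y d n) {F : FramedPerm d n → 𝕃}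
    (hF : F ∈ LinearMap.range (orbitMap hζ n)) :
    rep hζ n X F ∈ LinearMap.range (orbitMap hζ n) := by
  obtain ⟨X', rfl⟩ := hF
  exact ⟨X * X', by simp [orbitMap]⟩

theorem braidOp_apply_mem_range (i : ℕ) (hi : i + 1 < n) {F : FramedPerm d n → 𝕃}
    (hF : F ∈ LinearMap.range (orbitMap hζ n)) :
    braidOp (pu - pu⁻¹) ⟨i, by omega⟩ ⟨i + 1, hi⟩ F ∈ LinearMap.range (orbitMap hζ n) := by
  have := rep_apply_mem_range hζ (g d n (i + 1)) hF
  rwa [g, rep_proj, lift_repGen_fg ζ ⟨by omega, by omega⟩] at this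

theorem loopOp_apply_mem_range (hn : 0 < n) {F : FramedPerm d n → 𝕃}
    (hF : F ∈ LinearMap.range (orbitMap hζ n)) :
    loopOp (pv - pv⁻¹) ⟨0, hn⟩ F ∈ LinearMap.range (orbitMap hζ n) := by
  have := rep_apply_mem_range hζ (b d n) hF
  rwa [b, rep_proj, lift_repGen_fb ζ hn] at this

theorem framingOp_pow_apply_mem_range (j : Fin n) (m : ℕ) {F : FramedPerm d n → 𝕃}
    (hF : F ∈ LinearMap.range (orbitMap hζ n)) :
    (framingOp ζ j ^ m) F ∈ LinearMap.range (orbitMap hζ n) := by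
  have := rep_apply_mem_range hζ (t d n (j + 1) ^ m) hF
  rwa [map_pow, t, rep_proj, lift_repGen_ft ζ ⟨by omega, by omega⟩] at this

theorem ite_colour_mem_range (j : Fin n) (c : Fin d) {F : FramedPerm d n → 𝕃}
    (hF : F ∈ LinearMap.range (orbitMap hζ n)) :
    (fun w => if w.colour j = c then F w else 0) ∈ LinearMap.range (orbitMap hζ n) := by
  rw [← funext (sum_smul_framingOp_apply hζ j c F), LinearMap.smul_apply, LinearMap.sum_apply]
  exact Submodule.smul_mem _ _ (Submodule.sum_mem _ fun m _ => Submodule.smul_mem _ _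
    (framingOp_pow_apply_mem_range hζ j m hF))

theorem single_one_mem_range (c : Fin n → Fin d) :
    Pi.single ((1, fun _ => true, c) : FramedPerm d n) 1 ∈ LinearMap.range (orbitMap hζ n) := by
  have h (s : Finset (Fin n)) :
      (fun w : FramedPerm d n => if ∀ j ∈ s, w.colour j = c j then cyclicVector d n w else 0)
        ∈ LinearMap.range (orbitMap hζ n) := by
    induction s using Finset.induction_on with
    | empty => exact ⟨1, by simp [orbitMap]⟩
    | insert j s _ ih =>
      convert ite_colour_mem_range hζ j (c j) ih using 2 with w
      simp only [forall_mem_insert, ite_and]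
  convert h univ using 1
  funext ⟨σ, s, c'⟩
  simp only [Pi.single_apply, cyclicVector, Prod.mk.injEq, mem_univ, true_implies, colour,
    ← funext_iff (f := c'), ← ite_and, and_assoc, and_comm (a := c' = c)]

theorem single_permute_swap_mem_range (i : ℕ) (hi : i + 1 < n) {w : FramedPerm d n}
    (hw : Pi.single w 1 ∈ LinearMap.range (orbitMap hζ n)) :
    Pi.single (w.permute (Equiv.swap ⟨i, by omega⟩ ⟨i + 1, hi⟩)) 1
      ∈ LinearMap.range (orbitMap hζ n) := by
  set i' : Fin n := ⟨i, by omega⟩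
  set j' : Fin n := ⟨i + 1, hi⟩
  have hsingle : Pi.single (w.permute (Equiv.swap i' j')) 1
      = braidOp (pu - pu⁻¹) i' j' (Pi.single w 1)
        - braidCoeff (pu - pu⁻¹) (w.colour i') (w.colour j') (w.value i') (w.value j')
          • (Pi.single w 1 : FramedPerm d n → 𝕃) := by
    funext x
    have hx : x.permute (Equiv.swap i' j') = w ↔ x = w.permute (Equiv.swap i' j') := by
      constructor <;> rintro rfl <;> rw [permute_swap_permute_swap]
    simp only [Pi.sub_apply, Pi.smul_apply, braidOp_apply, Pi.single_apply, smul_eq_mul, hx]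
    by_cases h : x = w
    · rw [h]; ring
    · simp [h]
  rw [hsingle]
  exact Submodule.sub_mem _ (braidOp_apply_mem_range hζ i hi hw) (Submodule.smul_mem _ _ hw)

theorem single_negate_zero_mem_range (hn : 0 < n) {w : FramedPerm d n}
    (hw : Pi.single w 1 ∈ LinearMap.range (orbitMap hζ n)) :
    Pi.single (w.negate ⟨0, hn⟩) 1 ∈ LinearMap.range (orbitMap hζ n) := by
  set i' : Fin n := ⟨0, hn⟩
  have hsingle : Pi.single (w.negate i') 1 = loopOp (pv - pv⁻¹) i' (Pi.single w 1)
      - loopCoeff (pv - pv⁻¹) (w.colour i') (w.value i')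
        • (Pi.single w 1 : FramedPerm d n → 𝕃) := by
    funext x
    have hx : x.negate i' = w ↔ x = w.negate i' := by
      constructor <;> rintro rfl <;> rw [negate_negate]
    simp only [Pi.sub_apply, Pi.smul_apply, loopOp_apply, Pi.single_apply, smul_eq_mul, hx]
    by_cases h : x = w
    · rw [h]; ring
    · simp [h]
  rw [hsingle]
  exact Submodule.sub_mem _ (loopOp_apply_mem_range hζ hn hw) (Submodule.smul_mem _ _ hw)

theorem single_permute_mem_range (π : Equiv.Perm (Fin n)) {w : FramedPerm d n}
    (hw : Pi.single w 1 ∈ LinearMap.range (orbitMap hζ n)) :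
    Pi.single (w.permute π) 1 ∈ LinearMap.range (orbitMap hζ n) := by
  rcases n with _ | n
  · rwa [Subsingleton.elim π 1, permute_one]
  have hπ : π ∈ Submonoid.closure
      (Set.range fun i : Fin n => Equiv.swap i.castSucc i.succ) := by
    rw [Equiv.Perm.mclosure_swap_castSucc_succ]; trivial
  induction hπ using Submonoid.closure_induction generalizing w with
  | mem _ h =>
    obtain ⟨i, rfl⟩ := h
    exact single_permute_swap_mem_range hζ i (by omega) hw
  | one => rwa [permute_one]
  | mul π ρ _ _ hπ hρ => rw [← permute_permute]; exact hρ (hπ hw)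

theorem single_negate_mem_range (i : Fin n) {w : FramedPerm d n}
    (hw : Pi.single w 1 ∈ LinearMap.range (orbitMap hζ n)) :
    Pi.single (w.negate i) 1 ∈ LinearMap.range (orbitMap hζ n) := by
  have := single_permute_mem_range hζ (Equiv.swap ⟨0, i.pos⟩ i)
    (single_negate_zero_mem_range hζ i.pos
      (single_permute_mem_range hζ (Equiv.swap ⟨0, i.pos⟩ i) hw))
  rwa [negate_permute, permute_swap_permute_swap, Equiv.swap_apply_left] at this

theorem single_mem_range (w : FramedPerm d n) :
    Pi.single w 1 ∈ LinearMap.range (orbitMap hζ n) := by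
  obtain ⟨σ, s, c⟩ := w
  have h (S : Finset (Fin n)) : Pi.single ((σ, fun i => decide (i ∉ S), c) : FramedPerm d n) 1
      ∈ LinearMap.range (orbitMap hζ n) := by
    induction S using Finset.induction_on with
    | empty =>
      convert single_permute_mem_range hζ σ (single_one_mem_range hζ (c ∘ σ.symm)) using 2
      simp only [permute, one_mul, Prod.mk.injEq, true_and]
      exact ⟨by ext; simp, by ext; simp⟩
    | insert j S hj ih =>
      convert single_negate_mem_range hζ j ih using 2
      simp only [negate, Prod.mk.injEq, true_and, and_true]
      funext i
      by_cases hij : i = j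
      · subst hij; simp [hj]
      · simp [hij]
  convert h {i | s i = false} using 4
  simp

theorem orbitMap_surjective : Function.Surjective (orbitMap hζ n) := by
  rw [← LinearMap.range_eq_top, Submodule.eq_top_iff']
  intro F
  rw [← univ_sum_single F]
  refine Submodule.sum_mem _ fun w _ => ?_
  have := Submodule.smul_mem _ (F w) (single_mem_range hζ w)
  rwa [← Pi.single_smul, smul_eq_mul, mul_one] at this

end Cyclic

theorem exists_isPrimitiveRoot (d : ℕ) [NeZero d] : ∃ ζ : 𝕃, IsPrimitiveRoot ζ d :=
  ⟨algebraMap ℂ 𝕃 _, (Complex.isPrimitiveRoot_exp d (NeZero.ne d)).map_of_injective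
    (algebraMap ℂ 𝕃).injective⟩

theorem factorial_mul_pow_le_finrank (d n : ℕ) [NeZero d] [FiniteDimensional 𝕃 (Y d n)] :
    n.factorial * (2 * d) ^ n ≤ Module.finrank 𝕃 (Y d n) := by
  obtain ⟨ζ, hζ⟩ := exists_isPrimitiveRoot d
  have := LinearMap.finrank_le_finrank_of_surjective (orbitMap_surjective (n := n) hζ)
  rw [Module.finrank_fintype_fun_eq_card] at this
  simpa [Fintype.card_perm, mul_pow] using this

/-! ### Freeness over the previous algebra and the basis -/

/-- Indices of the elements of `M_{d,n+1}`; the second component is `j - 1` in `m^±_{n+1,j,a}`. -/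
abbrev MIndex (d n : ℕ) : Type := Bool × Fin (n + 1) × Fin d

/-- The element of `M_{d,n+1}` with a given index. -/
def mOfIndex (i : MIndex d n) : Y d (n + 1) := mElt d (n + 1) i.1 (i.2.1 + 1) i.2.2 (n + 1)

/-- The combinations of the elements of `M_{d,n+1}` with coefficients in `Y_n` on the left. -/
def mCombination (d n : ℕ) : (MIndex d n → Y d n) →ₗ[𝕃] Y d (n + 1) :=
  LinearMap.lsum 𝕃 (fun _ => Y d n) 𝕃 fun i =>
    (LinearMap.mulRight 𝕃 (mOfIndex i)).comp (incl d n).toLinearMap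

theorem mCombination_apply (f : MIndex d n → Y d n) :
    mCombination d n f = ∑ i, ι (f i) * mOfIndex i := by
  simp [mCombination]

theorem mCombination_single (i : MIndex d n) (W : Y d n) :
    mCombination d n (Pi.single i W) = ι W * mOfIndex i :=
  LinearMap.lsum_piSingle ..

theorem mOfIndex_false_last (a : Fin d) :
    mOfIndex (n := n) (false, Fin.last n, a) = τ[n + 1] ^ (a : ℕ) :=
  mElt_self _ _

theorem mOfIndex_true_last (a : Fin d) :
    mOfIndex (n := n) (true, Fin.last n, a) = β[n + 1] * τ[n + 1] ^ (a : ℕ) :=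
  mElt_self _ _

theorem g_mul_incl_mOfIndex (i : MIndex d n) :
    γ[n + 1] * ι (mOfIndex i) = mOfIndex (n := n + 1) (i.1, i.2.1.castSucc, i.2.2) := by
  change _ = mElt d (n + 2) i.1 (i.2.1 + 1) i.2.2 (n + 1 + 1)
  rw [mOfIndex, incl_mElt _ _ (by omega) (by omega) le_rfl, mElt_succ (k := n + 1) _ _ (by omega)]

theorem range_mOfIndex (d n : ℕ) :
    Set.range (mOfIndex (d := d) (n := n)) = M d (n + 1) (n + 1) := by
  ext m
  constructor
  · rintro ⟨⟨s, j, a⟩, rfl⟩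
    exact ⟨s, j + 1, a, by omega, by omega, a.2, rfl⟩
  · rintro ⟨s, j, a, hj, hjn, ha, rfl⟩
    obtain ⟨j, rfl⟩ := Nat.exists_eq_add_of_le' hj
    exact ⟨(s, ⟨j, hjn⟩, ⟨a, ha⟩), rfl⟩

theorem incl_mul_mOfIndex_mem_range (i : MIndex d n) (W : Y d n) :
    ι W * mOfIndex i ∈ LinearMap.range (mCombination d n) :=
  ⟨_, mCombination_single i W⟩

theorem gBimodule_le_range (h : Function.Surjective (mCombination d n)) :
    gBimodule d (n + 1) ≤ LinearMap.range (mCombination d (n + 1)) := by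
  refine gBimodule_induction fun A C => ?_
  obtain ⟨f, rfl⟩ := h C
  simp only [mCombination_apply, map_sum, map_mul, mul_sum, mul_assoc]
  refine sum_mem fun i _ => ?_
  rw [← mul_assoc (γ[n + 1]), g_mul_incl_incl, mul_assoc, g_mul_incl_mOfIndex, ← mul_assoc,
    ← map_mul]
  exact incl_mul_mOfIndex_mem_range _ _

/-- The identification of `Y_{d,0}^B` with the ground field, as a linear equivalence. -/
def groundEquiv (d : ℕ) : Y d 0 ≃ₗ[𝕃] 𝕃 :=
  LinearEquiv.ofBijective (ground d).toLinearMap (ground_bijective d)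

section NeZero
variable [NeZero d]

theorem incl_mul_t_pow_mem_range (W : Y d n) (a : ℕ) :
    ι W * τ[n + 1] ^ a ∈ LinearMap.range (mCombination d n) := by
  have := incl_mul_mOfIndex_mem_range (false, Fin.last n, ⟨a % d, Nat.mod_lt _ (NeZero.pos d)⟩) W
  rwa [mOfIndex_false_last, t_pow_mod ⟨by omega, le_rfl⟩] at this

theorem incl_mul_bAt_mem_range (W : Y d n) (a : ℕ) :
    ι W * (β[n + 1] * τ[n + 1] ^ a) ∈ LinearMap.range (mCombination d n) := by
  have := incl_mul_mOfIndex_mem_range (true, Fin.last n, ⟨a % d, Nat.mod_lt _ (NeZero.pos d)⟩) W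
  rwa [mOfIndex_true_last, t_pow_mod ⟨by omega, le_rfl⟩] at this

theorem mCombination_surjective_of_gBimodule_le
    (h : gBimodule d n ≤ LinearMap.range (mCombination d n)) :
    Function.Surjective (mCombination d n) := by
  intro X
  induction X using succ_induction with
  | t_pow W a => exact incl_mul_t_pow_mem_range W a
  | bAt_t_pow W a => exact incl_mul_bAt_mem_range W a
  | gBimodule X hX => exact h hX
  | add _ _ hX hX' =>
    obtain ⟨f, rfl⟩ := hX
    obtain ⟨f', rfl⟩ := hX'
    exact ⟨f + f', map_add ..⟩

theorem mCombination_surjective (d n : ℕ) [NeZero d] : Function.Surjective (mCombination d n) := by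
  refine mCombination_surjective_of_gBimodule_le ?_
  induction n with
  | zero => exact gBimodule_zero.trans_le bot_le
  | succ n ih => exact gBimodule_le_range (mCombination_surjective_of_gBimodule_le ih)

instance (d n : ℕ) [NeZero d] : FiniteDimensional 𝕃 (Y d n) := by
  induction n with
  | zero => exact Module.Finite.equiv (groundEquiv d).symm
  | succ n ih => exact Module.Finite.of_surjective _ (mCombination_surjective d n)

theorem finrank_mIndex_fun (d n : ℕ) [NeZero d] :
    Module.finrank 𝕃 (MIndex d n → Y d n) = 2 * d * (n + 1) * Module.finrank 𝕃 (Y d n) := by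
  simp only [Module.finrank_pi_fintype, sum_const, card_univ, Fintype.card_prod,
    Fintype.card_bool, Fintype.card_fin, smul_eq_mul]
  ring

theorem finrank_Y (d n : ℕ) [NeZero d] :
    Module.finrank 𝕃 (Y d n) = n.factorial * (2 * d) ^ n := by
  refine le_antisymm ?_ (factorial_mul_pow_le_finrank d n)
  induction n with
  | zero => simp [(groundEquiv d).finrank_eq]
  | succ n ih =>
    calc Module.finrank 𝕃 (Y d (n + 1))
        ≤ 2 * d * (n + 1) * Module.finrank 𝕃 (Y d n) := finrank_mIndex_fun d n ▸
          LinearMap.finrank_le_finrank_of_surjective (mCombination_surjective d n)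
      _ ≤ 2 * d * (n + 1) * (n.factorial * (2 * d) ^ n) := Nat.mul_le_mul_left _ ih
      _ = (n + 1).factorial * (2 * d) ^ (n + 1) := by rw [Nat.factorial_succ, pow_succ]; ring

theorem mCombination_bijective (d n : ℕ) [NeZero d] : Function.Bijective (mCombination d n) := by
  refine ⟨(LinearMap.injective_iff_surjective_of_finrank_eq_finrank ?_).mpr ?_, ?_⟩
  · rw [finrank_mIndex_fun, finrank_Y, finrank_Y, Nat.factorial_succ, pow_succ]
    ring
  all_goals exact mCombination_surjective d n

/-- `Y_{n+1}` is a free left `Y_n`-module on `M_{d,n+1}`. -/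
def mCombinationEquiv (d n : ℕ) [NeZero d] : (MIndex d n → Y d n) ≃ₗ[𝕃] Y d (n + 1) :=
  LinearEquiv.ofBijective (mCombination d n) (mCombination_bijective d n)

theorem mCombinationEquiv_single (i : MIndex d n) (W : Y d n) :
    mCombinationEquiv d n (Pi.single i W) = ι W * mOfIndex i :=
  mCombination_single i W

theorem exists_basis_range_eq_C (d n : ℕ) [NeZero d] :
    ∃ (I : Type) (B : Module.Basis I 𝕃 (Y d n)), Set.range B = C d n := by
  induction n with
  | zero =>
    refine ⟨Unit, (Module.Basis.singleton Unit 𝕃).map (groundEquiv d).symm, ?_⟩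
    have hone : groundEquiv d 1 = 1 := map_one (ground d)
    simp [C, ← hone]
  | succ n ih =>
    obtain ⟨I, B, hB⟩ := ih
    refine ⟨_, (Pi.basis fun _ : MIndex d n => B).map (mCombinationEquiv d n), ?_⟩
    rw [C, ← hB, ← range_mOfIndex]
    ext X
    simp only [Set.mem_range, Sigma.exists, Module.Basis.map_apply, Pi.basis_apply,
      mCombinationEquiv_single]
    constructor
    · rintro ⟨i, k, rfl⟩
      exact ⟨B k, ⟨k, rfl⟩, mOfIndex i, ⟨i, rfl⟩, rfl⟩
    · rintro ⟨_, ⟨k, rfl⟩, _, ⟨i, rfl⟩, rfl⟩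
      exact ⟨i, k, rfl⟩

theorem linearIndepOn_C (d n : ℕ) [NeZero d] : LinearIndepOn 𝕃 id (C d n) := by
  obtain ⟨I, B, hB⟩ := exists_basis_range_eq_C d n
  exact hB ▸ B.linearIndependent.linearIndepOn_id

theorem span_C (d n : ℕ) [NeZero d] : Submodule.span 𝕃 (C d n) = ⊤ := by
  obtain ⟨I, B, hB⟩ := exists_basis_range_eq_C d n
  exact hB ▸ B.span_eq

end NeZero

/-! ### The relative trace -/

open scoped Fin.CommRing in
theorem sum_mul_reflect {R : Type*} [CommSemiring R] [NeZero d] (f h : Fin d → R) (a c : ℕ) :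
    ∑ m ∈ range d, f ↑(d - m + a) * h ↑(m + c) = ∑ m ∈ range d, h ↑(d - m + a) * f ↑(m + c) := by
  have sum_eq (f h : Fin d → R) :
      ∑ m ∈ range d, f ↑(d - m + a) * h ↑(m + c) = ∑ i : Fin d, f (a - i) * h (i + c) := by
    rw [sum_range]
    refine sum_congr rfl fun i _ => ?_
    congr 2
    · rw [Nat.cast_add, Nat.cast_sub i.2.le, Fin.natCast_self, Fin.cast_val_eq_self]; ring
    · rw [Nat.cast_add, Fin.cast_val_eq_self]
  rw [sum_eq, sum_eq, ← Equiv.sum_comp (Equiv.subLeft ((a : Fin d) - c))]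
  refine sum_congr rfl fun i _ => ?_
  rw [mul_comm]
  congr 2 <;> simp only [Equiv.subLeft_apply] <;> ring

section Trace
open scoped Fin.CommRing
variable [NeZero d] (x y : Fin d → 𝕃)

/-- The value of the relative trace on an element of `M_{d,n+1}`. -/
def relTrValue (i : MIndex d n) : Y d n :=
  if i.2.1 = Fin.last n then (if i.1 then y i.2.2 else x i.2.2) • 1
  else pz • mElt d n i.1 (i.2.1 + 1) i.2.2 n

/-- The relative trace `tr_{n+1} : Y_{n+1} → Y_n` with parameters `z`, `x`, `y`, defined through the
freeness of `Y_{n+1}` over `Y_n`. -/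
def relTr (n : ℕ) : Y d (n + 1) →ₗ[𝕃] Y d n :=
  (LinearMap.lsum 𝕃 (fun _ => Y d n) 𝕃 fun i => LinearMap.mulRight 𝕃 (relTrValue x y i)).comp
    (mCombinationEquiv d n).symm.toLinearMap

theorem relTr_incl_mul_mOfIndex (W : Y d n) (i : MIndex d n) :
    relTr x y n (ι W * mOfIndex i) = W * relTrValue x y i := by
  rw [relTr, ← mCombinationEquiv_single, LinearMap.comp_apply, LinearEquiv.coe_coe,
    LinearEquiv.symm_apply_apply, LinearMap.lsum_piSingle, LinearMap.mulRight_apply]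

theorem relTr_incl_mul (W : Y d n) (X : Y d (n + 1)) :
    relTr x y n (ι W * X) = W * relTr x y n X := by
  obtain ⟨f, rfl⟩ := mCombination_surjective d n X
  simp only [mCombination_apply, mul_sum, map_sum, ← mul_assoc, ← map_mul,
    relTr_incl_mul_mOfIndex]

theorem relTr_t_pow (a : ℕ) : relTr x y n (τ[n + 1] ^ a) = x a • 1 := by
  have := relTr_incl_mul_mOfIndex x y (n := n) 1 (false, Fin.last n, a)
  rwa [mOfIndex_false_last, Fin.val_natCast, t_pow_mod ⟨by omega, le_rfl⟩, map_one, one_mul,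
    one_mul, relTrValue, if_pos rfl, if_neg Bool.false_ne_true] at this

theorem relTr_bAt_mul_t_pow (a : ℕ) : relTr x y n (β[n + 1] * τ[n + 1] ^ a) = y a • 1 := by
  have := relTr_incl_mul_mOfIndex x y (n := n) 1 (true, Fin.last n, a)
  rwa [mOfIndex_true_last, Fin.val_natCast, t_pow_mod ⟨by omega, le_rfl⟩, map_one, one_mul,
    one_mul, relTrValue, if_pos rfl, if_pos rfl] at this

theorem relTr_g_mul_incl (C : Y d (n + 1)) :
    relTr x y (n + 1) (γ[n + 1] * ι C) = pz • C := by
  obtain ⟨f, rfl⟩ := mCombination_surjective d n C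
  simp only [mCombination_apply, map_sum, mul_sum, smul_sum]
  refine sum_congr rfl fun i _ => ?_
  rw [map_mul (incl d (n + 1)), ← mul_assoc, g_mul_incl_incl, mul_assoc, g_mul_incl_mOfIndex,
    relTr_incl_mul_mOfIndex, relTrValue, if_neg (Fin.castSucc_lt_last _).ne, mul_smul_comm]
  rfl

theorem relTr_incl_mul_g_mul_incl (A C : Y d (n + 1)) :
    relTr x y (n + 1) (ι A * γ[n + 1] * ι C) = pz • (A * C) := by
  rw [mul_assoc, relTr_incl_mul, relTr_g_mul_incl, mul_smul_comm]

theorem relTr_mul_incl_of_mem_gBimodule {X : Y d (n + 1)} (hX : X ∈ gBimodule d n) (W : Y d n) :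
    relTr x y n (X * ι W) = relTr x y n X * W := by
  obtain _ | n := n
  · rw [gBimodule_zero, Submodule.mem_bot] at hX
    simp only [hX, zero_mul, map_zero]
  · refine gBimodule_induction (p := LinearMap.eqLocus
      ((relTr x y (n + 1)).comp (LinearMap.mulRight 𝕃 (ι W)))
      ((LinearMap.mulRight 𝕃 W).comp (relTr x y (n + 1)))) (fun A C => ?_) hX
    simp only [LinearMap.mem_eqLocus, LinearMap.comp_apply, LinearMap.mulRight_apply]
    rw [mul_assoc, ← map_mul, relTr_incl_mul_g_mul_incl, relTr_incl_mul_g_mul_incl, smul_mul_assoc,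
      mul_assoc]

theorem relTr_bAt_commutator_last (a : ℕ) :
    relTr x y (n + 1) ((β[n + 2] * ι β[n + 1] - ι β[n + 1] * β[n + 2]) * τ[n + 2] ^ a) = 0 := by
  rw [bAt_commutator, smul_mul_assoc, sum_mul, map_smul, map_sum, sum_eq_zero, smul_zero]
  intro m _
  have hpow (p q r : ℕ) : τ[n + 1] ^ p * (τ[n + 1] ^ q * (τ[n + 1] ^ r * (β[n + 1] * β[n + 1])))
      = τ[n + 1] ^ (p + q + r) * (β[n + 1] * β[n + 1]) := by
    simp only [pow_add, mul_assoc]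
  have hleft : β[n + 1] * τ[n + 1] ^ m * τ[n + 1] ^ a * (τ[n + 1] ^ (d - m) * β[n + 1])
      = τ[n + 1] ^ (m + a + (d - m)) * (β[n + 1] * β[n + 1]) := by
    rw [mul_assoc β[n + 1], ← pow_add, mul_assoc β[n + 1], ← mul_assoc (_ ^ (m + a)), ← pow_add,
      ← mul_assoc, ← t_pow_mul_bAt, mul_assoc]
  have hright : τ[n + 1] ^ (d - m) * τ[n + 1] ^ a * (τ[n + 1] ^ m * (β[n + 1] * β[n + 1]))
      = τ[n + 1] ^ (m + a + (d - m)) * (β[n + 1] * β[n + 1]) := by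
    rw [mul_assoc, hpow, show d - m + a + m = m + a + (d - m) by omega]
  rw [sub_mul, map_sub, incl_mul_g_mul_incl_mul_t_pow, incl_mul_g_mul_incl_mul_t_pow,
    relTr_incl_mul_g_mul_incl, relTr_incl_mul_g_mul_incl, hleft, hright, sub_self]

theorem relTr_bAt_commutator (W : Y d n) (a : ℕ) :
    relTr x y n ((β[n + 1] * ι W - ι W * β[n + 1]) * τ[n + 1] ^ a) = 0 := by
  refine (bAt_commutator_mem (K := gBimodule d n ⊓
    LinearMap.ker ((relTr x y n).comp (LinearMap.mulRight 𝕃 (τ[n + 1] ^ a))))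
    (fun W X hX => ⟨incl_mul_mem_gBimodule W hX.1, ?_⟩)
    (fun W X hX => ⟨mul_incl_mem_gBimodule W hX.1, ?_⟩)
    (fun hn => ⟨bAt_commutator_mem_gBimodule _, ?_⟩) W).2
  · have hX0 : relTr x y n (X * τ[n + 1] ^ a) = 0 := hX.2
    change relTr x y n (ι W * X * _) = 0
    rw [mul_assoc, relTr_incl_mul, hX0, mul_zero]
  · have hX0 : relTr x y n (X * τ[n + 1] ^ a) = 0 := hX.2
    change relTr x y n (X * ι W * _) = 0
    rw [mul_assoc, ← t_pow_mul_incl, ← mul_assoc,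
      relTr_mul_incl_of_mem_gBimodule x y (mul_t_pow_mem_gBimodule a hX.1), hX0, zero_mul]
  · obtain ⟨n, rfl⟩ := Nat.exists_eq_add_of_le' hn
    exact relTr_bAt_commutator_last x y a

theorem relTr_mul_incl (X : Y d (n + 1)) (W : Y d n) :
    relTr x y n (X * ι W) = relTr x y n X * W := by
  induction X using succ_induction with
  | t_pow V a =>
    rw [mul_assoc, t_pow_mul_incl, relTr_incl_mul, relTr_incl_mul, relTr_incl_mul, relTr_t_pow]
    simp only [mul_smul_comm, smul_mul_assoc, mul_one]
  | bAt_t_pow V a =>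
    have hcomm : β[n + 1] * τ[n + 1] ^ a * ι W = ι W * (β[n + 1] * τ[n + 1] ^ a)
        + (β[n + 1] * ι W - ι W * β[n + 1]) * τ[n + 1] ^ a := by
      rw [mul_assoc, t_pow_mul_incl]
      noncomm_ring
    rw [mul_assoc, hcomm, relTr_incl_mul, map_add, relTr_bAt_commutator, add_zero, relTr_incl_mul,
      relTr_incl_mul, relTr_bAt_mul_t_pow]
    simp only [mul_smul_comm, smul_mul_assoc, mul_one]
  | gBimodule X hX => exact relTr_mul_incl_of_mem_gBimodule x y hX W
  | add X X' hX hX' => rw [add_mul, map_add, map_add, hX, hX', add_mul]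

theorem relTr_isRelTrace : IsRelTrace d x y (relTr x y) := by
  intro n w _ a
  refine ⟨?_, ?_, fun s k hk hkn => ?_⟩
  · rw [relTr_incl_mul, relTr_t_pow, Fin.cast_val_eq_self, mul_smul_comm, mul_one]
  · rw [relTr_incl_mul, relTr_bAt_mul_t_pow, Fin.cast_val_eq_self, mul_smul_comm, mul_one]
  · obtain ⟨n, rfl⟩ := Nat.exists_eq_add_of_le' (hk.trans hkn)
    rw [mElt_succ _ _ hkn, ← incl_mElt _ _ hk hkn le_rfl, relTr_incl_mul, relTr_g_mul_incl,
      mul_smul_comm]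

variable {x y} in
theorem IsRelTrace.unique {tr tr' : (n : ℕ) → Y d (n + 1) →ₗ[𝕃] Y d n} (h : IsRelTrace d x y tr)
    (h' : IsRelTrace d x y tr') : tr' = tr := by
  funext n
  refine LinearMap.ext_on (span_C d (n + 1)) ?_
  rintro _ ⟨w, hw, m, ⟨s, j, a, hj, hjn, ha, rfl⟩, rfl⟩
  obtain ⟨htr_t, htr_b, htr_m⟩ := h n w hw ⟨a, ha⟩
  obtain ⟨htr_t', htr_b', htr_m'⟩ := h' n w hw ⟨a, ha⟩
  rcases hjn.lt_or_eq with hlt | rfl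
  · exact (htr_m' s j hj (by omega)).trans (htr_m s j hj (by omega)).symm
  · cases s
    · simpa [mElt_self] using htr_t'.trans htr_t.symm
    · simpa [mElt_self] using htr_b'.trans htr_b.symm

end Trace

/-! ### Relative traces of products with `gₙ₊₁` -/

theorem e_eq_sum : e d (n + 2) (n + 1)
    = (d : 𝕃)⁻¹ • ∑ m ∈ range d, ι (τ[n + 1] ^ m) * τ[n + 2] ^ (d - m) := by
  simp only [e, map_pow, incl_t_last]

theorem e_eq_sum_reflect : e d (n + 2) (n + 1)
    = (d : 𝕃)⁻¹ • ∑ m ∈ range d, ι (τ[n + 1] ^ (d - m)) * τ[n + 2] ^ m := by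
  simp only [e, map_pow, incl_t_last]
  rw [sum_pow_mul_pow_reflect (t_pow_d d _ _ ⟨by omega, by omega⟩)
    (t_pow_d d _ _ ⟨by omega, le_rfl⟩)]

theorem bAt_mul_t_pow_mul_g (a : ℕ) :
    β[n + 2] * τ[n + 2] ^ a * γ[n + 1] = γ[n + 1] * ι (β[n + 1] * τ[n + 1] ^ a) := by
  rw [mul_assoc, t_pow_mul_g, ← mul_assoc, bAt_mul_g, mul_assoc, map_mul]

theorem incl_t_pow_mul_bAt (a : ℕ) : ι (τ[n + 1] ^ a) * β[n + 2] = β[n + 2] * ι (τ[n + 1] ^ a) := by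
  rw [map_pow, incl_t_last]
  exact ((t_commute_bAt ⟨by omega, by omega⟩ ⟨by omega, le_rfl⟩).pow_left a).eq

theorem bAt_mul_e : β[n + 2] * e d (n + 2) (n + 1) = e d (n + 2) (n + 1) * β[n + 2] := by
  rw [e_eq_sum, mul_smul_comm, smul_mul_assoc, mul_sum, sum_mul]
  congr 1
  refine sum_congr rfl fun m _ => ?_
  rw [← mul_assoc, ← incl_t_pow_mul_bAt, mul_assoc, mul_assoc, t_pow_mul_bAt]

theorem incl_g_mul_bAt : ι γ[n + 1] * β[n + 3] = β[n + 3] * ι γ[n + 1] := by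
  rw [incl_g ⟨by omega, le_rfl⟩]
  exact (g_commute_bAt_of_gt (by omega) ⟨by omega, le_rfl⟩).eq

theorem g_mul_bAt : γ[n + 1] * β[n + 2] = ι β[n + 1] * γ[n + 1]
    - κ • ∑ m ∈ range d, ι (β[n + 1] * τ[n + 1] ^ m) * τ[n + 2] ^ (d - m)
    + κ • ∑ m ∈ range d, ι (τ[n + 1] ^ m) * (β[n + 2] * τ[n + 2] ^ (d - m)) := by
  have hconj : γ⁻¹[n + 1] * β[n + 2] = ι β[n + 1] * γ⁻¹[n + 1] := by
    rw [bAt_eq_conj, ← mul_assoc, ← mul_assoc, gInv_mul_g_last, one_mul]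
  rw [gInv_last_eq_sub_sum, sub_mul, mul_sub, sub_eq_iff_eq_add] at hconj
  rw [hconj]
  simp only [smul_mul_assoc, mul_smul_comm, sum_mul, mul_sum, map_mul, mul_assoc, t_pow_mul_bAt]

theorem g_mul_incl_bAt_mul_bAt :
    γ[n + 1] * ι β[n + 1] * β[n + 2] = ι β[n + 1] * γ[n + 1] * ι β[n + 1] := by
  rw [bAt_eq_conj, ← mul_assoc, ← mul_assoc, ← bAt_braid_last, mul_assoc, g_mul_gInv_last, mul_one]

section Trace
open scoped Fin.CommRing
variable [NeZero d] (x y : Fin d → 𝕃)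
local notation "tr" => relTr x y

theorem relTr_g : tr (n + 1) γ[n + 1] = pz • 1 := by
  simpa using relTr_g_mul_incl x y (n := n) 1

theorem relTr_t_pow_mul_g (a : ℕ) : tr (n + 1) (τ[n + 2] ^ a * γ[n + 1]) = pz • τ[n + 1] ^ a := by
  rw [t_pow_mul_g, relTr_g_mul_incl]

theorem relTr_bAt_mul_t_pow_mul_g (a : ℕ) :
    tr (n + 1) (β[n + 2] * τ[n + 2] ^ a * γ[n + 1]) = pz • (β[n + 1] * τ[n + 1] ^ a) := by
  rw [bAt_mul_t_pow_mul_g, relTr_g_mul_incl]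

theorem relTr_mul_t (X : Y d (n + 1)) : tr n (X * τ[n + 1]) = tr n (τ[n + 1] * X) := by
  have ht (W : Y d n) : τ[n + 1] * ι W = ι W * τ[n + 1] := (t_commute_incl W).eq
  induction X using succ_induction with
  | t_pow W a => rw [mul_assoc, ← mul_assoc τ[n + 1], ht, mul_assoc, pow_mul_comm']
  | bAt_t_pow W a =>
    have hb : τ[n + 1] * β[n + 1] = β[n + 1] * τ[n + 1] := by simpa using t_pow_mul_bAt (n := n) 1
    rw [mul_assoc, mul_assoc, ← mul_assoc τ[n + 1], ht, mul_assoc, ← mul_assoc τ[n + 1], hb,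
      mul_assoc, pow_mul_comm']
  | gBimodule X hX =>
    obtain _ | n := n
    · rw [gBimodule_zero, Submodule.mem_bot] at hX
      rw [hX, zero_mul, mul_zero]
    refine gBimodule_induction (p := LinearMap.eqLocus
      ((tr (n + 1)).comp (LinearMap.mulRight 𝕃 τ[n + 2]))
      ((tr (n + 1)).comp (LinearMap.mulLeft 𝕃 τ[n + 2]))) (fun A C => ?_) hX
    change tr (n + 1) (ι A * γ[n + 1] * ι C * τ[n + 2])
      = tr (n + 1) (τ[n + 2] * (ι A * γ[n + 1] * ι C))
    rw [← pow_one τ[n + 2], incl_mul_g_mul_incl_mul_t_pow, mul_assoc (ι A) γ[n + 1],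
      t_pow_mul_incl_assoc, ← mul_assoc (_ ^ 1), t_pow_mul_g, mul_assoc γ[n + 1],
      ← map_mul (incl d _), ← mul_assoc, relTr_incl_mul_g_mul_incl, relTr_incl_mul_g_mul_incl,
      mul_assoc]
  | add X X' hX hX' => rw [add_mul, mul_add, map_add, map_add, hX, hX']

theorem relTr_g_mul_bAt_mul_t_pow (a : ℕ) : tr (n + 1) (γ[n + 1] * β[n + 2] * τ[n + 2] ^ a)
    = pz • (β[n + 1] * τ[n + 1] ^ a)
      - κ • ∑ m ∈ range d, x ↑(d - m + a) • (β[n + 1] * τ[n + 1] ^ m)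
      + κ • ∑ m ∈ range d, y ↑(d - m + a) • τ[n + 1] ^ m := by
  have hfirst := incl_mul_g_mul_incl_mul_t_pow (d := d) β[n + 1] 1 a
  rw [map_one, mul_one, mul_one] at hfirst
  rw [g_mul_bAt, add_mul, sub_mul, hfirst]
  simp only [smul_mul_assoc, sum_mul, map_add, map_sub, map_smul, map_sum, mul_assoc, ← pow_add,
    relTr_incl_mul, relTr_g, relTr_t_pow, relTr_bAt_mul_t_pow, mul_smul_comm, mul_one]

theorem relTr_relTr_g_mul_bAt_mul_t_pow_mul (a c : ℕ) :
    tr n (tr (n + 1) (γ[n + 1] * β[n + 2] * τ[n + 2] ^ a) * τ[n + 1] ^ c)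
      = (pz * y ↑(a + c)) • 1 := by
  rw [relTr_g_mul_bAt_mul_t_pow]
  simp only [add_mul, sub_mul, smul_mul_assoc, sum_mul, map_add, map_sub, map_smul, map_sum,
    mul_assoc, ← pow_add, relTr_t_pow, relTr_bAt_mul_t_pow, smul_smul, ← sum_smul]
  rw [sum_mul_reflect, sub_add_cancel]

theorem relTr_relTr_g_mul_bAt_mul_t_pow_mul_g (a : ℕ) :
    tr (n + 1) (tr (n + 2) (γ[n + 2] * β[n + 3] * τ[n + 3] ^ a) * γ[n + 1])
      = pz • tr (n + 1) (γ[n + 1] * β[n + 2] * τ[n + 2] ^ a) := by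
  simp only [relTr_g_mul_bAt_mul_t_pow, add_mul, sub_mul, smul_mul_assoc, sum_mul, map_add, map_sub,
    map_smul, map_sum, relTr_t_pow_mul_g, relTr_bAt_mul_t_pow_mul_g, smul_add, smul_sub, smul_sum,
    smul_smul, mul_comm]

theorem relTr_t_pow_mul_e_mul_g (a : ℕ) :
    tr (n + 1) (τ[n + 2] ^ a * (e d (n + 2) (n + 1) * γ[n + 1])) = pz • τ[n + 1] ^ a := by
  have hterm {m : ℕ} (hm : m ∈ range d) :
      tr (n + 1) (τ[n + 2] ^ a * (ι (τ[n + 1] ^ m) * τ[n + 2] ^ (d - m) * γ[n + 1]))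
        = pz • τ[n + 1] ^ a := by
    rw [mul_assoc (ι _), t_pow_mul_incl_assoc, ← mul_assoc (_ ^ a), ← pow_add, relTr_incl_mul,
      relTr_t_pow_mul_g, mul_smul_comm, ← pow_add,
      show m + (a + (d - m)) = a + d by have := mem_range.mp hm; omega, pow_add,
      t_pow_d d (n + 1) (n + 1) ⟨by omega, le_rfl⟩, mul_one]
  rw [e_eq_sum, smul_mul_assoc, mul_smul_comm, map_smul, sum_mul, mul_sum, map_sum,
    sum_congr rfl fun m hm => hterm hm, sum_const, card_range, ← Nat.cast_smul_eq_nsmul 𝕃,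
    inv_smul_smul₀ (NeZero.ne _)]

theorem relTr_t_pow_mul_e_mul_g_sub (a : ℕ) :
    tr (n + 1) (τ[n + 2] ^ a * (e d (n + 2) (n + 1) * γ[n + 1] - γ[n + 1])) = 0 := by
  rw [mul_sub, map_sub, relTr_t_pow_mul_e_mul_g, relTr_t_pow_mul_g, sub_self]

theorem relTr_bAt_mul_t_pow_mul_e_mul_g_sub (a : ℕ) :
    tr (n + 1) (β[n + 2] * τ[n + 2] ^ a * (e d (n + 2) (n + 1) * γ[n + 1] - γ[n + 1])) = 0 := by
  have hmove : β[n + 2] * τ[n + 2] ^ a * (e d (n + 2) (n + 1) * γ[n + 1] - γ[n + 1])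
      = τ[n + 2] ^ a * (e d (n + 2) (n + 1) * γ[n + 1] - γ[n + 1]) * ι β[n + 1] := by
    rw [← t_pow_mul_bAt, mul_assoc, mul_assoc, mul_sub, sub_mul, mul_assoc (e _ _ _), ← bAt_mul_g,
      ← mul_assoc β[n + 2], bAt_mul_e, mul_assoc (e _ _ _)]
  rw [hmove, relTr_mul_incl, relTr_t_pow_mul_e_mul_g_sub, zero_mul]

end Trace

/-! ### The trace property -/

theorem IsTracial.map_mul_e_mul_g {T : Y d (n + 2) →ₗ[𝕃] 𝕃} (hT : IsTracial T)
    (V V' : Y d (n + 1)) :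
    T (ι V * γ[n + 1] * ι V' * (e d (n + 2) (n + 1) * γ[n + 1]))
      = T (γ[n + 1] * (ι V * (e d (n + 2) (n + 1) * γ[n + 1]) * ι V')) := by
  have hcycle (m : ℕ) :
      γ[n + 1] * (ι V * (ι (τ[n + 1] ^ m) * τ[n + 2] ^ (d - m) * γ[n + 1]) * ι V')
        = (ι (τ[n + 1] ^ (d - m)) * γ[n + 1] * ι V) * (γ[n + 1] * ι V' * τ[n + 2] ^ m) := by
    rw [← t_pow_mul_incl, mul_assoc (τ[n + 2] ^ _), ← g_mul_t_pow, ← mul_assoc (ι V),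
      ← t_pow_mul_incl, ← g_mul_t_pow, mul_assoc γ[n + 1] (ι V'), ← t_pow_mul_incl]
    simp only [mul_assoc]
  nth_rewrite 1 [e_eq_sum_reflect]
  rw [e_eq_sum]
  simp only [smul_mul_assoc, mul_smul_comm, mul_sum, sum_mul, map_smul, map_sum]
  congr 1
  refine sum_congr rfl fun m _ => ?_
  rw [hcycle, hT (_ * ι V), ← mul_assoc _ _ (ι V), hT _ (ι V),
    ← t_pow_mul_incl m (τ[n + 1] ^ (d - m))]
  simp only [mul_assoc]

theorem eq_algebraMap_ground (W : Y d 0) : W = algebraMap 𝕃 _ (ground d W) :=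
  (ground_bijective d).1 (by rw [AlgHom.commutes]; rfl)

theorem commute_b_one (X : Y d 1) : Commute (b d 1) X := by
  have hι (W : Y d 0) : Commute (b d 1) (ι W) := by
    rw [eq_algebraMap_ground W, AlgHom.commutes]
    exact (Algebra.commutes _ _).symm
  have ht (a : ℕ) : Commute (b d 1) (t d 1 1 ^ a) :=
    ((t_commute_b ⟨le_rfl, le_rfl⟩).pow_left a).symm
  induction X using succ_induction with
  | t_pow W a => exact (hι W).mul_right (ht a)
  | bAt_t_pow W a => exact (hι W).mul_right ((Commute.refl (b d 1)).mul_right (ht a))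
  | gBimodule X hX =>
    rw [gBimodule_zero, Submodule.mem_bot] at hX
    rw [hX]; exact Commute.zero_right _
  | add X X' hX hX' => exact hX.add_right hX'

section Trace
open scoped Fin.CommRing
variable [NeZero d] (x y : Fin d → 𝕃)
local notation "tr" => relTr x y
local notation "Tr" => bigTr d (relTr x y)

theorem bigTr_succ (X : Y d (n + 1)) : Tr (n + 1) X = Tr n (tr n X) := rfl

/-- The average `A ↦ tr (gₙ₊₁ A gₙ₊₁)` of `Yₙ₊₁` over its two embeddings by `gₙ₊₁`. -/
def gAverage (n : ℕ) : Y d (n + 1) →ₗ[𝕃] Y d (n + 1) :=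
  tr (n + 1) ∘ₗ LinearMap.mulLeftRight 𝕃 (γ[n + 1], γ[n + 1]) ∘ₗ (ι).toLinearMap

theorem gAverage_apply (A : Y d (n + 1)) :
    gAverage x y n A = tr (n + 1) (γ[n + 1] * ι A * γ[n + 1]) := by
  simp [gAverage]

theorem gAverage_incl_mul (W : Y d n) (A : Y d (n + 1)) :
    gAverage x y n (ι W * A) = ι W * gAverage x y n A := by
  rw [gAverage_apply, gAverage_apply, map_mul (incl d _), ← mul_assoc, g_mul_incl_incl, mul_assoc,
    mul_assoc, relTr_incl_mul, ← mul_assoc]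

theorem gAverage_mul_incl (W : Y d n) (A : Y d (n + 1)) :
    gAverage x y n (A * ι W) = gAverage x y n A * ι W := by
  rw [gAverage_apply, gAverage_apply, map_mul (incl d _), ← mul_assoc,
    mul_assoc _ (ι (ι W)) γ[n + 1], ← g_mul_incl_incl, ← mul_assoc, relTr_mul_incl]

theorem gAverage_of_commute {Z : Y d (n + 1)} (hZ : Commute τ[n + 1] Z) :
    gAverage x y n Z
      = tr (n + 1) (γ[n + 1] * ι Z * γ⁻¹[n + 1]) + ((pu - pu⁻¹) * pz) • Z := by
  have hterm (m : ℕ) (hm : m ∈ range d) :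
      tr (n + 1) (ι (τ[n + 1] ^ (d - m)) * γ[n + 1] * ι (Z * τ[n + 1] ^ m)) = pz • Z := by
    rw [relTr_incl_mul_g_mul_incl, ← mul_assoc, (hZ.pow_left _).eq, mul_assoc, ← pow_add,
      Nat.sub_add_cancel (mem_range.mp hm).le, t_pow_d d (n + 1) (n + 1) ⟨by omega, le_rfl⟩,
      mul_one]
  have hd : (d : 𝕃) ≠ 0 := NeZero.ne _
  rw [gAverage_apply, g_mul_incl_mul_g, map_add, map_smul, map_sum, sum_congr rfl hterm, sum_const,
    card_range, ← Nat.cast_smul_eq_nsmul 𝕃, smul_smul, smul_smul, heckeCoeff]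
  congr 2
  field_simp

/-- The defect of `gAverage` from the combination of the identity and the relative trace that it
equals on `Yₙ tₙ₊₁^a` and `Yₙ bₙ₊₁ tₙ₊₁^a`. -/
def gDefect (n : ℕ) : Y d (n + 1) →ₗ[𝕃] Y d (n + 1) :=
  gAverage x y n - ((pu - pu⁻¹) * pz) • LinearMap.id - (ι).toLinearMap ∘ₗ tr n

theorem gAverage_eq (A : Y d (n + 1)) :
    gAverage x y n A = gDefect x y n A + ((pu - pu⁻¹) * pz) • A + ι (tr n A) := by
  change _ = gAverage x y n A - ((pu - pu⁻¹) * pz) • A - ι (tr n A) + _ + _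
  abel

theorem gDefect_incl_mul (W : Y d n) (A : Y d (n + 1)) :
    gDefect x y n (ι W * A) = ι W * gDefect x y n A := by
  have h := gAverage_incl_mul x y W A
  rw [gAverage_eq, gAverage_eq, relTr_incl_mul, map_mul (incl d _), mul_add, mul_add,
    mul_smul_comm, add_left_inj, add_left_inj] at h
  exact h

theorem gDefect_mul_incl (W : Y d n) (A : Y d (n + 1)) :
    gDefect x y n (A * ι W) = gDefect x y n A * ι W := by
  have h := gAverage_mul_incl x y W A
  rw [gAverage_eq, gAverage_eq, relTr_mul_incl, map_mul (incl d _),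
    add_mul _ _ (ι W), add_mul _ _ (ι W), smul_mul_assoc, add_left_inj, add_left_inj] at h
  exact h

theorem gDefect_incl_mul_t_pow (W : Y d n) (a : ℕ) :
    gDefect x y n (ι W * τ[n + 1] ^ a) = 0 := by
  have h := gAverage_of_commute x y ((Commute.refl τ[n + 1]).pow_right a)
  rw [gAverage_eq, g_mul_incl_t_pow_mul_gInv, relTr_t_pow, relTr_t_pow, map_smul, map_one,
    add_assoc, add_comm (_ • τ[n + 1] ^ a), add_eq_right] at h
  rw [gDefect_incl_mul, h, mul_zero]

theorem gDefect_incl_mul_bAt_mul_t_pow (W : Y d n) (a : ℕ) :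
    gDefect x y n (ι W * (β[n + 1] * τ[n + 1] ^ a)) = 0 := by
  have hcomm : Commute τ[n + 1] (β[n + 1] * τ[n + 1] ^ a) :=
    (t_commute_bAt ⟨by omega, le_rfl⟩ ⟨by omega, le_rfl⟩).mul_right
      ((Commute.refl _).pow_right a)
  have h := gAverage_of_commute x y hcomm
  rw [gAverage_eq, g_mul_incl_bAt_mul_gInv, relTr_bAt_mul_t_pow, relTr_bAt_mul_t_pow, map_smul,
    map_one, add_assoc, add_comm (_ • (_ * _)), add_eq_right] at h
  rw [gDefect_incl_mul, h, mul_zero]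

theorem gDefect_g : gDefect x y (n + 1) γ[n + 1]
    = ((pu - pu⁻¹) * pz) • (e d (n + 2) (n + 1) * γ[n + 1] - γ[n + 1]) := by
  have haverage : gAverage x y (n + 1) γ[n + 1] = pz • (γ[n + 1] * γ[n + 1]) := by
    have h := g_mul_incl_gBimodule_mul_g (d := d) (n := n) 1 1
    simp only [map_one, one_mul, mul_one] at h
    rw [gAverage_apply, h, relTr_incl_mul_g_mul_incl]
  rw [gAverage_eq, relTr_g, g_sq d (n + 2) (n + 1) ⟨by omega, le_rfl⟩, map_smul, map_one, smul_add,
    add_comm (pz • 1), add_left_inj, smul_smul, mul_comm pz] at haverage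
  rw [smul_sub, ← haverage, add_sub_cancel_right]

theorem bigTr_mul_gDefect_g (hTr : IsTracial (Tr (n + 2))) (A : Y d (n + 2)) :
    Tr (n + 2) (A * gDefect x y (n + 1) γ[n + 1])
      = Tr (n + 2) (γ[n + 1] * gDefect x y (n + 1) A) := by
  induction A using succ_induction with
  | t_pow V a =>
    rw [gDefect_incl_mul_t_pow, mul_zero, map_zero, gDefect_g, mul_smul_comm, map_smul, bigTr_succ,
      mul_assoc, relTr_incl_mul, relTr_t_pow_mul_e_mul_g_sub, mul_zero, map_zero, smul_zero]
  | bAt_t_pow V a =>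
    rw [gDefect_incl_mul_bAt_mul_t_pow, mul_zero, map_zero, gDefect_g, mul_smul_comm, map_smul,
      bigTr_succ, mul_assoc, relTr_incl_mul, relTr_bAt_mul_t_pow_mul_e_mul_g_sub, mul_zero,
      map_zero, smul_zero]
  | gBimodule X hX =>
    refine gBimodule_induction (p := LinearMap.eqLocus
      (Tr (n + 2) ∘ₗ LinearMap.mulRight 𝕃 (gDefect x y (n + 1) γ[n + 1]))
      (Tr (n + 2) ∘ₗ LinearMap.mulLeft 𝕃 γ[n + 1] ∘ₗ gDefect x y (n + 1))) (fun V V' => ?_) hX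
    change Tr (n + 2) (ι V * γ[n + 1] * ι V' * gDefect x y (n + 1) γ[n + 1])
      = Tr (n + 2) (γ[n + 1] * gDefect x y (n + 1) (ι V * γ[n + 1] * ι V'))
    rw [gDefect_mul_incl, gDefect_incl_mul, gDefect_g, mul_smul_comm, mul_smul_comm,
      smul_mul_assoc, mul_smul_comm, map_smul, map_smul, mul_sub (ι V * γ[n + 1] * ι V'),
      mul_sub (ι V), sub_mul _ _ (ι V'), mul_sub γ[n + 1], map_sub, map_sub,
      hTr.map_mul_e_mul_g, hTr _ γ[n + 1]]
  | add A A' hA hA' => rw [add_mul, map_add, map_add, mul_add, map_add, hA, hA']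

theorem bigTr_mul_gDefect_of_mem_gBimodule (hTr : IsTracial (Tr (n + 1))) (A : Y d (n + 1))
    {X : Y d (n + 1)} (hX : X ∈ gBimodule d n) :
    Tr (n + 1) (A * gDefect x y n X) = Tr (n + 1) (X * gDefect x y n A) := by
  obtain _ | n := n
  · rw [gBimodule_zero, Submodule.mem_bot] at hX
    rw [hX, map_zero, mul_zero, zero_mul]
  refine gBimodule_induction (p := LinearMap.eqLocus
    (Tr (n + 2) ∘ₗ LinearMap.mulLeft 𝕃 A ∘ₗ gDefect x y (n + 1))
    (Tr (n + 2) ∘ₗ LinearMap.mulRight 𝕃 (gDefect x y (n + 1) A))) (fun W W' => ?_) hX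
  change Tr (n + 2) (A * gDefect x y (n + 1) (ι W * γ[n + 1] * ι W'))
    = Tr (n + 2) (ι W * γ[n + 1] * ι W' * gDefect x y (n + 1) A)
  have h := bigTr_mul_gDefect_g x y hTr (ι W' * A * ι W)
  rw [gDefect_mul_incl, gDefect_incl_mul] at h ⊢
  rw [← mul_assoc A, hTr _ (ι W'), mul_assoc (ι W), mul_assoc (ι W), hTr (ι W)]
  simp only [mul_assoc] at h ⊢
  exact h

theorem bigTr_mul_gDefect_of_gDefect_eq_zero (hTr : IsTracial (Tr (n + 1))) (A : Y d (n + 1))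
    {Z : Y d (n + 1)} (hZ : gDefect x y n Z = 0) :
    Tr (n + 1) (Z * gDefect x y n A) = 0 := by
  induction A using succ_induction with
  | t_pow V a => rw [gDefect_incl_mul_t_pow, mul_zero, map_zero]
  | bAt_t_pow V a => rw [gDefect_incl_mul_bAt_mul_t_pow, mul_zero, map_zero]
  | gBimodule X hX =>
    rw [bigTr_mul_gDefect_of_mem_gBimodule x y hTr Z hX, hZ, mul_zero, map_zero]
  | add X X' hX hX' => rw [map_add, mul_add, map_add, hX, hX', add_zero]

theorem bigTr_mul_gDefect (hTr : IsTracial (Tr (n + 1))) (A A' : Y d (n + 1)) :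
    Tr (n + 1) (A * gDefect x y n A') = Tr (n + 1) (A' * gDefect x y n A) := by
  have of_eq_zero {Z : Y d (n + 1)} (hZ : gDefect x y n Z = 0) :
      Tr (n + 1) (A * gDefect x y n Z) = Tr (n + 1) (Z * gDefect x y n A) := by
    rw [bigTr_mul_gDefect_of_gDefect_eq_zero x y hTr A hZ, hZ, mul_zero, map_zero]
  induction A' using succ_induction with
  | t_pow V a => exact of_eq_zero (gDefect_incl_mul_t_pow x y V a)
  | bAt_t_pow V a => exact of_eq_zero (gDefect_incl_mul_bAt_mul_t_pow x y V a)
  | gBimodule X hX => exact bigTr_mul_gDefect_of_mem_gBimodule x y hTr A hX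
  | add X X' hX hX' => rw [map_add, mul_add, map_add, add_mul, map_add, hX, hX']

theorem bigTr_mul_gAverage (hTr₀ : IsTracial (Tr n)) (hTr : IsTracial (Tr (n + 1)))
    (A C : Y d (n + 1)) :
    Tr (n + 1) (A * gAverage x y n C) = Tr (n + 1) (gAverage x y n A * C) := by
  have hincl (A C : Y d (n + 1)) : Tr (n + 1) (A * ι (tr n C)) = Tr n (tr n A * tr n C) := by
    rw [bigTr_succ, relTr_mul_incl]
  rw [hTr (gAverage x y n A) C, gAverage_eq, gAverage_eq]
  simp only [mul_add, map_add, mul_smul_comm, map_smul, hincl]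
  rw [bigTr_mul_gDefect x y hTr A C, hTr A C, hTr₀ (tr n A)]

theorem bigTr_mul_g_of_mem_gBimodule (hTr₀ : IsTracial (Tr n)) (hTr : IsTracial (Tr (n + 1)))
    {X : Y d (n + 2)} (hX : X ∈ gBimodule d (n + 1)) :
    Tr (n + 2) (X * γ[n + 1]) = Tr (n + 2) (γ[n + 1] * X) := by
  suffices hle : gBimodule d (n + 1) ≤ LinearMap.eqLocus
      (Tr (n + 2) ∘ₗ LinearMap.mulRight 𝕃 γ[n + 1])
      (Tr (n + 2) ∘ₗ LinearMap.mulLeft 𝕃 γ[n + 1]) from hle hX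
  refine gBimodule_induction fun A C => ?_
  change Tr (n + 2) (ι A * γ[n + 1] * ι C * γ[n + 1])
    = Tr (n + 2) (γ[n + 1] * (ι A * γ[n + 1] * ι C))
  rw [mul_assoc (ι A), mul_assoc (ι A), ← mul_assoc γ[n + 1],
    ← mul_assoc (γ[n + 1] * ι A), bigTr_succ x y (n := n + 1), bigTr_succ x y (n := n + 1),
    relTr_incl_mul, relTr_mul_incl, ← gAverage_apply, ← gAverage_apply,
    bigTr_mul_gAverage x y hTr₀ hTr]

/-- The twofold relative trace of the commutator with `gₙ₊₁`. -/
def relTrGComm (n : ℕ) : Y d (n + 2) →ₗ[𝕃] Y d n :=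
  tr n ∘ₗ tr (n + 1) ∘ₗ (LinearMap.mulRight 𝕃 γ[n + 1] - LinearMap.mulLeft 𝕃 γ[n + 1])

theorem relTrGComm_apply (X : Y d (n + 2)) :
    relTrGComm x y n X = tr n (tr (n + 1) (X * γ[n + 1] - γ[n + 1] * X)) := rfl

theorem bigTr_relTrGComm (X : Y d (n + 2)) :
    Tr n (relTrGComm x y n X) = Tr (n + 2) (X * γ[n + 1]) - Tr (n + 2) (γ[n + 1] * X) :=
  map_sub (Tr (n + 2)) _ _

theorem relTrGComm_incl_incl_mul (W : Y d n) (X : Y d (n + 2)) :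
    relTrGComm x y n (ι (ι W) * X) = W * relTrGComm x y n X := by
  rw [relTrGComm_apply, relTrGComm_apply, ← mul_assoc γ[n + 1], g_mul_incl_incl, mul_assoc,
    mul_assoc, ← mul_sub, relTr_incl_mul, relTr_incl_mul]

theorem relTrGComm_mul_incl_incl (W : Y d n) (X : Y d (n + 2)) :
    relTrGComm x y n (X * ι (ι W)) = relTrGComm x y n X * W := by
  rw [relTrGComm_apply, relTrGComm_apply, mul_assoc X, ← g_mul_incl_incl, ← mul_assoc, ← mul_assoc,
    ← sub_mul, relTr_mul_incl, relTr_mul_incl]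

theorem relTr_incl_mul_bAt_mul_t_pow_mul_g (A : Y d (n + 1)) (a : ℕ) :
    tr (n + 1) (ι A * (β[n + 2] * τ[n + 2] ^ a) * γ[n + 1])
      = pz • (A * (β[n + 1] * τ[n + 1] ^ a)) := by
  rw [mul_assoc, relTr_incl_mul, relTr_bAt_mul_t_pow_mul_g, mul_smul_comm]

theorem relTrGComm_t_pow_mul_bAt_mul_t_pow (a c : ℕ) :
    relTrGComm x y n (ι (τ[n + 1] ^ c) * (β[n + 2] * τ[n + 2] ^ a)) = 0 := by
  have hleft : γ[n + 1] * (ι (τ[n + 1] ^ c) * (β[n + 2] * τ[n + 2] ^ a))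
      = γ[n + 1] * β[n + 2] * τ[n + 2] ^ a * ι (τ[n + 1] ^ c) := by
    rw [← mul_assoc (ι _), incl_t_pow_mul_bAt, mul_assoc β[n + 2], ← t_pow_mul_incl]
    simp only [mul_assoc]
  rw [relTrGComm_apply, map_sub, hleft, relTr_mul_incl, map_sub,
    relTr_relTr_g_mul_bAt_mul_t_pow_mul, relTr_incl_mul_bAt_mul_t_pow_mul_g, ← mul_assoc,
    t_pow_mul_bAt, mul_assoc, ← pow_add, map_smul, relTr_bAt_mul_t_pow, smul_smul, add_comm c,
    sub_self]

theorem relTrGComm_bAt_mul_t_pow_mul_bAt_mul_t_pow (a c : ℕ) :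
    relTrGComm x y n (ι (β[n + 1] * τ[n + 1] ^ c) * (β[n + 2] * τ[n + 2] ^ a)) = 0 := by
  have hleft : γ[n + 1] * (ι (β[n + 1] * τ[n + 1] ^ c) * (β[n + 2] * τ[n + 2] ^ a))
      = ι β[n + 1] * γ[n + 1] * ι (β[n + 1] * τ[n + 1] ^ c) * τ[n + 2] ^ a := by
    rw [map_mul (incl d _), mul_assoc (ι _), ← mul_assoc (ι (_ ^ c)), incl_t_pow_mul_bAt]
    simp only [← mul_assoc]
    rw [g_mul_incl_bAt_mul_bAt]
  have hcomm : β[n + 1] * τ[n + 1] ^ a * (β[n + 1] * τ[n + 1] ^ c)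
      = β[n + 1] * τ[n + 1] ^ c * (β[n + 1] * τ[n + 1] ^ a) := by
    rw [mul_assoc, mul_assoc, ← mul_assoc (_ ^ a), ← mul_assoc (_ ^ c), t_pow_mul_bAt,
      t_pow_mul_bAt, mul_assoc, mul_assoc, ← pow_add, ← pow_add, add_comm a]
  rw [relTrGComm_apply, map_sub, hleft, incl_mul_g_mul_incl_mul_t_pow, relTr_incl_mul_g_mul_incl,
    relTr_incl_mul_bAt_mul_t_pow_mul_g, hcomm, sub_self, map_zero]

theorem relTrGComm_g_mul_bAt_mul_t_pow (a : ℕ) :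
    relTrGComm x y (n + 1) (ι γ[n + 1] * (β[n + 3] * τ[n + 3] ^ a)) = 0 := by
  have hleft : γ[n + 2] * (ι γ[n + 1] * (β[n + 3] * τ[n + 3] ^ a))
      = γ[n + 2] * β[n + 3] * τ[n + 3] ^ a * ι γ[n + 1] := by
    rw [← mul_assoc (ι _), incl_g_mul_bAt, mul_assoc β[n + 3], ← t_pow_mul_incl]
    simp only [mul_assoc]
  rw [relTrGComm_apply, map_sub, hleft, relTr_mul_incl, map_sub,
    relTr_relTr_g_mul_bAt_mul_t_pow_mul_g, relTr_incl_mul_bAt_mul_t_pow_mul_g, map_smul,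
    mul_assoc γ[n + 1], sub_self]

variable {x y}

theorem bigTr_relTrGComm_of_mem_gBimodule (hTr₀ : IsTracial (Tr n)) (hTr : IsTracial (Tr (n + 1)))
    {X : Y d (n + 1)} (hX : X ∈ gBimodule d n) (a : ℕ) :
    Tr n (relTrGComm x y n (ι X * (β[n + 2] * τ[n + 2] ^ a))) = 0 := by
  have of_mem {Z : Y d (n + 2)} (hZ : Z ∈ gBimodule d (n + 1)) : Tr n (relTrGComm x y n Z) = 0 := by
    rw [bigTr_relTrGComm, bigTr_mul_g_of_mem_gBimodule x y hTr₀ hTr hZ, sub_self]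
  obtain _ | n := n
  · rw [gBimodule_zero, Submodule.mem_bot] at hX
    simp only [hX, map_zero, zero_mul]
  suffices hle : gBimodule d (n + 1) ≤ LinearMap.ker (Tr (n + 1) ∘ₗ relTrGComm x y (n + 1) ∘ₗ
      LinearMap.mulRight 𝕃 (β[n + 3] * τ[n + 3] ^ a) ∘ₗ (ι).toLinearMap) from hle hX
  refine gBimodule_induction fun V V' => ?_
  change Tr (n + 1) (relTrGComm x y (n + 1)
    (ι (ι V * γ[n + 1] * ι V') * (β[n + 3] * τ[n + 3] ^ a))) = 0
  have hmem : ι (ι V * γ[n + 1])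
      * ((β[n + 3] * ι (ι V') - ι (ι V') * β[n + 3]) * τ[n + 3] ^ a) ∈ gBimodule d (n + 2) :=
    incl_mul_mem_gBimodule _ (mul_t_pow_mem_gBimodule a (bAt_commutator_mem_gBimodule _))
  have hmove : ι (ι V * γ[n + 1] * ι V') * (β[n + 3] * τ[n + 3] ^ a)
      = ι (ι V) * (ι γ[n + 1] * (β[n + 3] * τ[n + 3] ^ a)) * ι (ι V')
        - ι (ι V * γ[n + 1])
          * ((β[n + 3] * ι (ι V') - ι (ι V') * β[n + 3]) * τ[n + 3] ^ a) := by
    rw [sub_mul, mul_sub, mul_assoc β[n + 3], ← t_pow_mul_incl]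
    simp only [map_mul, mul_assoc]
    abel
  rw [hmove, map_sub, map_sub, of_mem hmem, relTrGComm_mul_incl_incl, relTrGComm_incl_incl_mul,
    relTrGComm_g_mul_bAt_mul_t_pow, mul_zero, zero_mul, map_zero, sub_zero]

theorem bigTr_incl_mul_t_pow_mul_g (hTr : IsTracial (Tr (n + 1))) (A : Y d (n + 1)) (a : ℕ) :
    Tr (n + 2) (ι A * τ[n + 2] ^ a * γ[n + 1]) = Tr (n + 2) (γ[n + 1] * (ι A * τ[n + 2] ^ a)) := by
  rw [mul_assoc, t_pow_mul_g, ← mul_assoc, ← t_pow_mul_incl, ← mul_assoc, g_mul_t_pow,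
    bigTr_succ x y (n := n + 1), bigTr_succ x y (n := n + 1), relTr_incl_mul_g_mul_incl,
    relTr_incl_mul_g_mul_incl, map_smul, map_smul, hTr]

theorem bigTr_relTrGComm_incl_mul_bAt_mul_t_pow (hTr₀ : IsTracial (Tr n))
    (hTr : IsTracial (Tr (n + 1))) (A : Y d (n + 1)) (a : ℕ) :
    Tr n (relTrGComm x y n (ι A * (β[n + 2] * τ[n + 2] ^ a))) = 0 := by
  induction A using succ_induction with
  | t_pow V c =>
    rw [map_mul (incl d _), mul_assoc, relTrGComm_incl_incl_mul,
      relTrGComm_t_pow_mul_bAt_mul_t_pow, mul_zero, map_zero]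
  | bAt_t_pow V c =>
    rw [map_mul (incl d _), mul_assoc, relTrGComm_incl_incl_mul,
      relTrGComm_bAt_mul_t_pow_mul_bAt_mul_t_pow, mul_zero, map_zero]
  | gBimodule X hX => exact bigTr_relTrGComm_of_mem_gBimodule hTr₀ hTr hX a
  | add A A' hA hA' => rw [map_add, add_mul, map_add, map_add, hA, hA', add_zero]

theorem g_mem_traceCommutant (hTr₀ : IsTracial (Tr n)) (hTr : IsTracial (Tr (n + 1))) :
    γ[n + 1] ∈ traceCommutant (Tr (n + 2)) := by
  intro X
  induction X using succ_induction with
  | t_pow A a => exact bigTr_incl_mul_t_pow_mul_g hTr A a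
  | bAt_t_pow A a =>
    rw [← sub_eq_zero, ← bigTr_relTrGComm]
    exact bigTr_relTrGComm_incl_mul_bAt_mul_t_pow hTr₀ hTr A a
  | gBimodule X hX => exact bigTr_mul_g_of_mem_gBimodule x y hTr₀ hTr hX
  | add X X' hX hX' => rw [add_mul, mul_add, map_add, map_add, hX, hX']

theorem incl_mem_traceCommutant (hTr : IsTracial (Tr n)) (W : Y d n) :
    ι W ∈ traceCommutant (Tr (n + 1)) := fun X => by
  rw [bigTr_succ, bigTr_succ, relTr_mul_incl, relTr_incl_mul, hTr]

theorem t_mem_traceCommutant : τ[n + 1] ∈ traceCommutant (Tr (n + 1)) := fun X => by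
  rw [bigTr_succ, bigTr_succ, relTr_mul_t]

variable (x y) in
theorem bigTr_isTracial (n : ℕ) : IsTracial (Tr n) := by
  suffices h : IsTracial (Tr n) ∧ IsTracial (Tr (n + 1)) from h.1
  induction n with
  | zero =>
    refine ⟨fun X X' => ?_, .of_forall_mem (mem_of_generators (fun _ X => ?_) (fun i hi => ?_)
      fun j hj => ?_)⟩
    · rw [eq_algebraMap_ground X, Algebra.commutes]
    · rw [(commute_b_one X).eq]
    · omega
    · obtain rfl : j = 1 := by omega
      exact t_mem_traceCommutant
  | succ n ih =>
    exact ⟨ih.2, .of_forall_mem (mem_of_last_generators (incl_mem_traceCommutant ih.2)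
      (g_mem_traceCommutant ih.1 ih.2) t_mem_traceCommutant)⟩

end Trace

/-! ### The Markov trace and its uniqueness -/

theorem IsMarkovTrace.apply_incl_mul_g_mul_incl {x y : Fin d → 𝕃}
    {Tr : (n : ℕ) → Y d n →ₗ[𝕃] 𝕃} (h : IsMarkovTrace d x y Tr)
    (A C : Y d (n + 1)) :
    Tr (n + 2) (ι A * γ[n + 1] * ι C) = pz * Tr (n + 1) (C * A) := by
  rw [h.comm (n + 2) (by omega), ← mul_assoc, ← map_mul, h.mul_g (n + 1) (by omega)]

section Markov
open scoped Fin.CommRing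
variable [NeZero d] {x y : Fin d → 𝕃}

variable (y) in
theorem bigTr_one (hx : x 0 = 1) (n : ℕ) : bigTr d (relTr x y) n 1 = 1 := by
  induction n with
  | zero => exact map_one (ground d)
  | succ n ih =>
    have h : relTr x y n 1 = 1 := by simpa [hx] using relTr_t_pow x y (n := n) 0
    rw [bigTr_succ, h, ih]

variable (y) in
theorem bigTr_isMarkovTrace (hx : x 0 = 1) : IsMarkovTrace d x y (bigTr d (relTr x y)) where
  one n _ := bigTr_one y hx n
  mul_g n hn X := by
    obtain ⟨n, rfl⟩ := Nat.exists_eq_add_of_le' hn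
    rw [bigTr_succ, relTr_incl_mul, relTr_g, mul_smul_comm, mul_one, map_smul, smul_eq_mul]
  mul_b_t n _ X m := by
    rw [mul_assoc, bigTr_succ, relTr_incl_mul, relTr_bAt_mul_t_pow, Fin.cast_val_eq_self,
      mul_smul_comm, mul_one, map_smul, smul_eq_mul]
  mul_t n _ X m := by
    rw [bigTr_succ, relTr_incl_mul, relTr_t_pow, Fin.cast_val_eq_self, mul_smul_comm, mul_one,
      map_smul, smul_eq_mul]
  comm n _ := bigTr_isTracial x y n

namespace IsMarkovTrace
variable {Tr Tr' : (n : ℕ) → Y d n →ₗ[𝕃] 𝕃}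

theorem apply_incl_mul_t_pow (h : IsMarkovTrace d x y Tr) (hn : 1 ≤ n) (X : Y d n) (a : ℕ) :
    Tr (n + 1) (ι X * τ[n + 1] ^ a) = x a * Tr n X := by
  rw [← t_pow_mod ⟨by omega, le_rfl⟩]
  exact h.mul_t n hn X a

theorem apply_incl_mul_bAt_mul_t_pow (h : IsMarkovTrace d x y Tr) (hn : 1 ≤ n) (X : Y d n)
    (a : ℕ) : Tr (n + 1) (ι X * (β[n + 1] * τ[n + 1] ^ a)) = y a * Tr n X := by
  rw [← t_pow_mod ⟨by omega, le_rfl⟩, ← mul_assoc]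
  exact h.mul_b_t n hn X a

theorem apply_eq_conj (h : IsMarkovTrace d x y Tr) (hx : x 0 = 1) (Z : Y d (n + 1)) :
    Tr (n + 1) Z = Tr (n + 2) (γ[n + 1] * ι Z * γ⁻¹[n + 1]) := by
  have hι : Tr (n + 2) (ι Z) = Tr (n + 1) Z := by
    simpa [hx] using h.apply_incl_mul_t_pow (by omega) Z 0
  rw [h.comm (n + 2) (by omega), ← mul_assoc, gInv_mul_g_last, one_mul, hι]

theorem apply_one_t_pow (h : IsMarkovTrace d x y Tr) (hx : x 0 = 1) (a : ℕ) :
    Tr 1 (t d 1 1 ^ a) = x a := by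
  have hstep := h.apply_incl_mul_t_pow le_rfl 1 a
  rw [map_one, one_mul, h.one 1 le_rfl, mul_one] at hstep
  rw [h.apply_eq_conj hx, g_mul_incl_t_pow_mul_gInv, hstep]

theorem apply_one_bAt_mul_t_pow (h : IsMarkovTrace d x y Tr) (hx : x 0 = 1) (a : ℕ) :
    Tr 1 (bAt d 1 1 * t d 1 1 ^ a) = y a := by
  have hstep := h.apply_incl_mul_bAt_mul_t_pow le_rfl 1 a
  rw [map_one, one_mul, h.one 1 le_rfl, mul_one] at hstep
  rw [h.apply_eq_conj hx, g_mul_incl_bAt_mul_gInv, hstep]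

theorem unique_one (h : IsMarkovTrace d x y Tr) (h' : IsMarkovTrace d x y Tr') (hx : x 0 = 1) :
    Tr' 1 = Tr 1 := by
  have hscalar (W : Y d 0) (X : Y d 1) : ι W * X = ground d W • X := by
    rw [Algebra.smul_def]
    conv_lhs => rw [eq_algebraMap_ground W, AlgHom.commutes]
  ext X
  induction X using succ_induction with
  | t_pow W a =>
    rw [hscalar, map_smul, map_smul, h.apply_one_t_pow hx, h'.apply_one_t_pow hx]
  | bAt_t_pow W a =>
    rw [hscalar, map_smul, map_smul, h.apply_one_bAt_mul_t_pow hx, h'.apply_one_bAt_mul_t_pow hx]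
  | gBimodule X hX =>
    rw [gBimodule_zero, Submodule.mem_bot] at hX
    rw [hX, map_zero, map_zero]
  | add X X' hX hX' => rw [map_add, map_add, hX, hX']

theorem unique (h : IsMarkovTrace d x y Tr) (h' : IsMarkovTrace d x y Tr') (hx : x 0 = 1)
    (hn : 1 ≤ n) : Tr' n = Tr n := by
  induction n, hn using Nat.le_induction with
  | base => exact h.unique_one h' hx
  | succ n hn ih =>
    ext X
    induction X using succ_induction with
    | t_pow W a => rw [h.apply_incl_mul_t_pow hn, h'.apply_incl_mul_t_pow hn, ih]
    | bAt_t_pow W a =>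
      rw [h.apply_incl_mul_bAt_mul_t_pow hn, h'.apply_incl_mul_bAt_mul_t_pow hn, ih]
    | gBimodule X hX =>
      obtain ⟨n, rfl⟩ := Nat.exists_eq_add_of_le' hn
      suffices hle : gBimodule d (n + 1) ≤ LinearMap.eqLocus (Tr' (n + 2)) (Tr (n + 2)) from hle hX
      refine gBimodule_induction fun A C => ?_
      change Tr' (n + 2) (ι A * γ[n + 1] * ι C) = Tr (n + 2) (ι A * γ[n + 1] * ι C)
      rw [h.apply_incl_mul_g_mul_incl, h'.apply_incl_mul_g_mul_incl, ih]
    | add X X' hX hX' => rw [map_add, map_add, hX, hX']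

end IsMarkovTrace
end Markov

end FramedB

end

theorem theorem5p7 (d : ℕ) [NeZero d] (x y : Fin d → FramedB.𝕃) (hx : x 0 = 1) :
    (∀ n : ℕ, LinearIndepOn FramedB.𝕃 id (FramedB.C d n) ∧
      Submodule.span FramedB.𝕃 (FramedB.C d n) = ⊤) ∧
    ∃ tr : (n : ℕ) → FramedB.Y d (n + 1) →ₗ[FramedB.𝕃] FramedB.Y d n,
      FramedB.IsRelTrace d x y tr ∧
      (∀ tr' : (n : ℕ) → FramedB.Y d (n + 1) →ₗ[FramedB.𝕃] FramedB.Y d n,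
        FramedB.IsRelTrace d x y tr' → tr' = tr) ∧
      FramedB.IsMarkovTrace d x y (FramedB.bigTr d tr) ∧
      (∀ Tr' : (n : ℕ) → FramedB.Y d n →ₗ[FramedB.𝕃] FramedB.𝕃,
        FramedB.IsMarkovTrace d x y Tr' → ∀ n : ℕ, 1 ≤ n → Tr' n = FramedB.bigTr d tr n) := by
  refine ⟨fun n => ⟨FramedB.linearIndepOn_C d n, FramedB.span_C d n⟩, FramedB.relTr x y,
    FramedB.relTr_isRelTrace x y, fun tr' h => (FramedB.relTr_isRelTrace x y).unique h,
    FramedB.bigTr_isMarkovTrace y hx, fun Tr' h n hn =>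
      (FramedB.bigTr_isMarkovTrace y hx).unique h hx hn⟩
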